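/- For graphs $G$ and $G'$ let $G\cup G'$ be their disjoint union, let $mG$ be the disjoint union of $m$ copies of $G$, and let $P_l$ be the path on $l$ vertices. For a positive integer $n$ and a graph $H$, the anti-Ramsey number $AR(n,H)$ is the maximum number of colors in an edge-coloring of the complete graph $K_n$ that contains no rainbow copy of $H$, i.e. no copy of $H$ whose edges have pairwise distinct colors. Let $k,t,n$ be integers with $t\ge k+1\ge 2$ and $n\ge 8k+2t-4$. Then \[ AR(n,kP_4\cup tP_2)=\begin{cases} 14 & \text{when } k=1,\ t=2,\ n=8,\\ t(2t+1)+2 & \text{when } k=1,\ t\ge 5,\ n=2t+4,\\ (2k+t-2)(4k+2t-3)+1 & \text{when } n\le \frac{5(2k+t)-7}{2} \text{ and not } (k=1,\ t\ge 5,\ n=2t+4),\\ (2k+t-2)\left(n-\frac{2k+t-1}{2}\right)+1 & \text{when } n\ge \frac{5(2k+t)-7}{2} \text{ and not } (k=1,\ t\ge 5,\ n=2t+4). \end{cases} \] (Where several cases apply, their values agree.) -/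

import Mathlib

open SimpleGraph

/-- The disjoint union `m G` of `m` vertex-disjoint copies of a graph `G`. -/
def copies {V : Type*} (m : ℕ) (G : SimpleGraph V) : SimpleGraph (Fin m × V) where
  Adj x y := x.1 = y.1 ∧ G.Adj x.2 y.2
  symm := ⟨fun _ _ h => ⟨h.1.symm, h.2.symm⟩⟩
  loopless := ⟨fun _ h => h.2.ne rfl⟩

/-- The linear forest `k P₄ ∪ t P₂`, where `P_l` is the path on `l` vertices. -/
def linearForest (k t : ℕ) : SimpleGraph ((Fin k × Fin 4) ⊕ (Fin t × Fin 2)) :=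
  copies k (pathGraph 4) ⊕g copies t (pathGraph 2)

/-- The edge-coloring `c` of the complete graph on `V` contains a rainbow copy of `H`: a (not
necessarily induced) copy of `H` all of whose edges have distinct colors. -/
def HasRainbowCopy {V K W : Type*} (c : TopEdgeLabeling V K) (H : SimpleGraph W) : Prop :=
  ∃ f : Copy H (⊤ : SimpleGraph V), Function.Injective fun e => c (f.toHom.mapEdgeSet e)

/-- The set of all `m` such that some edge-coloring of `K_n` with exactly `m` colors
(all of them used) contains no rainbow copy of `H`. -/
def rainbowFreeColorCounts {W : Type*} (n : ℕ) (H : SimpleGraph W) : Set ℕ :=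
  {m | ∃ c : TopEdgeLabeling (Fin n) (Fin m), Function.Surjective c ∧ ¬ HasRainbowCopy c H}

/-- The anti-Ramsey number `AR(n, H)`: the maximum number of colors in an edge-coloring of `K_n`
that contains no rainbow copy of `H`. -/
noncomputable def antiRamsey {W : Type*} (n : ℕ) (H : SimpleGraph W) : ℕ :=
  sSup (rainbowFreeColorCounts n H)

/-- The number of colors is at most the number of edges of `K_n`. -/
theorem bddAbove_rainbowFreeColorCounts {W : Type*} (n : ℕ) (H : SimpleGraph W) :
    BddAbove (rainbowFreeColorCounts n H) := by
  refine ⟨Nat.card (⊤ : SimpleGraph (Fin n)).edgeSet, ?_⟩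
  rintro m ⟨c, hc, -⟩
  simpa using Nat.card_le_card_of_surjective c hc

/-- The supremum that defines the anti-Ramsey number is a maximum as soon as some coloring
without a rainbow copy exists. -/
theorem isGreatest_antiRamsey {W : Type*} {n : ℕ} {H : SimpleGraph W}
    (h : (rainbowFreeColorCounts n H).Nonempty) :
    IsGreatest (rainbowFreeColorCounts n H) (antiRamsey n H) :=
  ⟨Nat.sSup_mem h (bddAbove_rainbowFreeColorCounts n H),
    fun _ hm => le_csSup (bddAbove_rainbowFreeColorCounts n H) hm⟩

set_option linter.unusedSectionVars false

/-! Put σ = 2k + t − 2. The end edges of the paths P₄ together with the edges P₂ form a matching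
with σ + 2 edges, so a coloring without a rainbow matching of that size has no rainbow forest
either. Two such colorings give the lower bounds: make a clique on 2σ + 1 vertices rainbow, or make
all edges meeting a fixed σ-set rainbow, and use one further color elsewhere. They have σ(2σ+1) + 1
and σn − σ(σ+1)/2 + 1 colors, and these agree at 2n = 5σ + 3. On exactly 2σ + 4 vertices the clique
coloring can be given a second extra color, which beats the star coloring once σ ≥ 5. The bound on n
admits n = 2σ + 4 only for k = 1, whence the exceptional case.

For the upper bound, one color more than both constructions (`Big`) forces a rainbow matching with σ
+ 2 edges (`bounds`). Then a graph with one edge of each color has so many edges, and so large a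
matching, that it contains the forest (`containsForest_of_card`).

The matching step is an induction on σ. Call a color private to a vertex if it disappears when the
vertex is deleted. If every vertex has a private color, deleting the two ends of a private edge and
using induction bounds all degrees in the representing graph from below. With respect to a maximum
matching M, two uncovered vertices have degree sum at most 2|M|, so everything is tight. An edge
between uncovered vertices repeats the color of an edge of M, and exchanging the two edges gives a
contradiction. If some vertex has no private color, it can be deleted, except near the smallest
orders. There the even order 2σ + 4 is decisive: a failure forces an almost rainbow clique on 2σ + 1
vertices plus three special vertices (`EvenExtremal`), and one more vertex destroys this structure.

The forest step counts edges around a maximum matching: too many edges between matching edges, or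
too many at uncovered vertices, give k disjoint paths P₄ that use up at most 2k matching edges. -/

namespace RainbowForest

/-! ### Edge sets, neighbourhoods and matchings. -/

section Basic

variable {V K : Type*} [DecidableEq V] [DecidableEq K]

/-- The edges of the complete graph on the vertex set `W`. -/
def pairs (W : Finset V) : Finset (Sym2 V) := W.sym2.filter fun e => ¬ e.IsDiag

/-- The vertices covered by a set of edges. -/
def cov (M : Finset (Sym2 V)) : Finset V := M.biUnion Sym2.toFinset

/-- The neighbours of `x` in the graph with edge set `G`. -/
def nbr (G : Finset (Sym2 V)) (x : V) : Finset V := (cov G).filter fun y => s(x, y) ∈ G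

/-- A set of pairwise disjoint edges. -/
structure IsMatch (M : Finset (Sym2 V)) : Prop where
  nd : ∀ e ∈ M, ¬ e.IsDiag
  disj : ∀ e ∈ M, ∀ f ∈ M, ∀ x, x ∈ e → x ∈ f → e = f

/-- The colors that `c` uses on the edges inside `W`. -/
def colors (c : Sym2 V → K) (W : Finset V) : Finset K := (pairs W).image c

/-- There is a rainbow matching with `s` edges inside `W`. -/
def HasRM (c : Sym2 V → K) (W : Finset V) (s : ℕ) : Prop :=
  ∃ M ⊆ pairs W, IsMatch M ∧ Set.InjOn c M ∧ M.card = s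

/-- `M` is at least as large as every matching contained in `G`. -/
def NoBigger (M G : Finset (Sym2 V)) : Prop := ∀ M' ⊆ G, IsMatch M' → M'.card ≤ M.card

/-- `G` is a rainbow set of edges inside `W` that uses every color occurring inside `W`. -/
structure IsRep (c : Sym2 V → K) (W : Finset V) (G : Finset (Sym2 V)) : Prop where
  sub : G ⊆ pairs W
  inj : Set.InjOn c G
  img : G.image c = colors c W

@[simp] theorem mk_mem_pairs {W : Finset V} {x y : V} :
    s(x, y) ∈ pairs W ↔ x ∈ W ∧ y ∈ W ∧ x ≠ y := by
  simp [pairs, and_assoc]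

theorem pairs_mono {W W' : Finset V} (h : W ⊆ W') : pairs W ⊆ pairs W' := by
  intro e
  induction e with
  | _ x y => simp only [mk_mem_pairs]; exact fun ⟨a, b, d⟩ => ⟨h a, h b, d⟩

theorem not_isDiag_of_mem_pairs {W : Finset V} {e : Sym2 V} (h : e ∈ pairs W) : ¬ e.IsDiag :=
  (Finset.mem_filter.1 h).2

theorem card_pairs (W : Finset V) : (pairs W).card = W.card.choose 2 := by
  rw [← Sym2.card_image_offDiag]
  congr 1
  ext e
  induction e with
  | _ x y =>
    simp only [mk_mem_pairs, Finset.mem_image, Finset.mem_offDiag, Prod.exists]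
    constructor
    · rintro ⟨a, b, d⟩; exact ⟨x, y, ⟨a, b, d⟩, rfl⟩
    · rintro ⟨a, b, ⟨h1, h2, h3⟩, h⟩
      rcases Sym2.eq_iff.1 h with ⟨rfl, rfl⟩ | ⟨rfl, rfl⟩
      · exact ⟨h1, h2, h3⟩
      · exact ⟨h2, h1, h3.symm⟩

@[simp] theorem mem_cov {M : Finset (Sym2 V)} {x : V} : x ∈ cov M ↔ ∃ e ∈ M, x ∈ e := by
  simp [cov]

theorem cov_subset {M : Finset (Sym2 V)} {W : Finset V} (h : M ⊆ pairs W) : cov M ⊆ W := by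
  intro x hx
  obtain ⟨e, he, hxe⟩ := mem_cov.1 hx
  have := (Finset.mem_filter.1 (h he)).1
  exact (Finset.mem_sym2_iff.1 this) x hxe

theorem cov_insert (M : Finset (Sym2 V)) (x y : V) :
    cov (insert s(x, y) M) = insert x (insert y (cov M)) := by
  ext z; simp; tauto

@[simp] theorem mem_nbr {G : Finset (Sym2 V)} {x y : V} : y ∈ nbr G x ↔ s(x, y) ∈ G := by
  simp only [nbr, Finset.mem_filter, and_iff_right_iff_imp]
  exact fun h => mem_cov.2 ⟨_, h, Sym2.mem_mk_right x y⟩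

theorem mem_nbr_comm {G : Finset (Sym2 V)} {x y : V} : y ∈ nbr G x ↔ x ∈ nbr G y := by
  rw [mem_nbr, mem_nbr, Sym2.eq_swap]

theorem card_filter_mem (G : Finset (Sym2 V)) (x : V) :
    (G.filter (x ∈ ·)).card = (nbr G x).card := by
  have : G.filter (x ∈ ·) = (nbr G x).image fun y => s(x, y) := by
    ext e
    simp only [Finset.mem_filter, Finset.mem_image, mem_nbr]
    constructor
    · rintro ⟨he, hx⟩
      obtain ⟨y, rfl⟩ := Sym2.mem_iff_exists.1 hx
      exact ⟨y, he, rfl⟩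
    · rintro ⟨y, hy, rfl⟩
      exact ⟨hy, Sym2.mem_mk_left x y⟩
  rw [this, Finset.card_image_of_injective]
  intro a b h
  exact Sym2.congr_right.1 h

theorem nbr_subset {G : Finset (Sym2 V)} {W : Finset V} (h : G ⊆ pairs W) (x : V) :
    nbr G x ⊆ W.erase x := by
  intro y hy
  have := mk_mem_pairs.1 (h (mem_nbr.1 hy))
  simp [this.2.1, this.2.2.symm]

theorem card_nbr_lt {G : Finset (Sym2 V)} {W : Finset V} (h : G ⊆ pairs W) {x : V} (hx : x ∈ W) :
    (nbr G x).card + 1 ≤ W.card := by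
  have := Finset.card_le_card (nbr_subset h x)
  rw [Finset.card_erase_of_mem hx] at this
  have := Finset.card_pos.2 ⟨x, hx⟩
  omega

/-- The edges of `G` are met by `S` or lie in the rest of the vertex set. -/
theorem card_le_sum_nbr_add {G : Finset (Sym2 V)} {W S : Finset V} (hG : G ⊆ pairs W) :
    G.card ≤ ∑ x ∈ S, (nbr G x).card + (W \ S).card.choose 2 := by
  have h : G ⊆ (S.biUnion fun x => G.filter (x ∈ ·)) ∪ pairs (W \ S) := by
    intro e he
    by_cases h : ∃ x ∈ S, x ∈ e
    · obtain ⟨x, hx, hxe⟩ := h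
      exact Finset.mem_union_left _ (Finset.mem_biUnion.2 ⟨x, hx, by simp [he, hxe]⟩)
    · push Not at h
      apply Finset.mem_union_right
      have := hG he
      revert h this
      induction e with
      | _ x y =>
        simp only [mk_mem_pairs, Finset.mem_sdiff]
        intro h h'
        exact ⟨⟨h'.1, fun hS => h x hS (by simp)⟩, ⟨h'.2.1, fun hS => h y hS (by simp)⟩, h'.2.2⟩
  calc G.card ≤ _ := Finset.card_le_card h
    _ ≤ _ := Finset.card_union_le _ _
    _ ≤ _ := by
      rw [card_pairs]
      gcongr
      refine Finset.card_biUnion_le.trans ?_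
      simp [card_filter_mem]

theorem IsMatch.mono {M M' : Finset (Sym2 V)} (h : IsMatch M) (h' : M' ⊆ M) : IsMatch M' :=
  ⟨fun e he => h.nd e (h' he), fun e he f hf => h.disj e (h' he) f (h' hf)⟩

theorem IsMatch.insert_edge {M : Finset (Sym2 V)} (h : IsMatch M) {x y : V} (hx : x ∉ cov M)
    (hy : y ∉ cov M) (hxy : x ≠ y) : IsMatch (insert s(x, y) M) := by
  simp only [mem_cov, not_exists, not_and] at hx hy
  constructor
  · intro e he
    rcases Finset.mem_insert.1 he with rfl | he
    · simpa using hxy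
    · exact h.nd e he
  · intro e he f hf z hze hzf
    rcases Finset.mem_insert.1 he with rfl | he' <;>
      rcases Finset.mem_insert.1 hf with rfl | hf'
    · rfl
    · rcases Sym2.mem_iff.1 hze with rfl | rfl
      · exact absurd hzf (hx f hf')
      · exact absurd hzf (hy f hf')
    · rcases Sym2.mem_iff.1 hzf with rfl | rfl
      · exact absurd hze (hx e he')
      · exact absurd hze (hy e he')
    · exact h.disj e he' f hf' z hze hzf

theorem notMem_of_notMem_cov {M : Finset (Sym2 V)} {x y : V} (hx : x ∉ cov M) : s(x, y) ∉ M :=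
  fun h => hx (mem_cov.2 ⟨_, h, by simp⟩)

theorem card_insert_edge {M : Finset (Sym2 V)} {x y : V} (hx : x ∉ cov M) :
    (insert s(x, y) M).card = M.card + 1 :=
  Finset.card_insert_of_notMem (notMem_of_notMem_cov hx)

theorem IsMatch.card_cov {M : Finset (Sym2 V)} (h : IsMatch M) : (cov M).card = 2 * M.card := by
  rw [cov, Finset.card_biUnion]
  · rw [Finset.sum_congr rfl fun e he => Sym2.card_toFinset_of_not_isDiag e (h.nd e he)]
    simp [mul_comm]
  · intro e he f hf hef
    rw [Function.onFun, Finset.disjoint_left]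
    intro x hx hx'
    exact hef (h.disj e he f hf x (by simpa using hx) (by simpa using hx'))

theorem IsMatch.mem_cov_erase {M : Finset (Sym2 V)} (h : IsMatch M) {a b : V} (hab : s(a, b) ∈ M)
    {x : V} : x ∈ cov (M.erase s(a, b)) ↔ x ∈ cov M ∧ x ≠ a ∧ x ≠ b := by
  constructor
  · intro hx
    obtain ⟨e, he, hxe⟩ := mem_cov.1 hx
    obtain ⟨hne, he'⟩ := Finset.mem_erase.1 he
    refine ⟨mem_cov.2 ⟨e, he', hxe⟩, ?_, ?_⟩
    · rintro rfl; exact hne (h.disj e he' _ hab x hxe (by simp))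
    · rintro rfl; exact hne (h.disj e he' _ hab x hxe (by simp))
  · rintro ⟨hx, hxa, hxb⟩
    obtain ⟨e, he, hxe⟩ := mem_cov.1 hx
    refine mem_cov.2 ⟨e, Finset.mem_erase.2 ⟨?_, he⟩, hxe⟩
    rintro rfl
    rcases Sym2.mem_iff.1 hxe with rfl | rfl
    · exact hxa rfl
    · exact hxb rfl

/-- The function that sends a covered vertex to the other end of its matching edge. -/
theorem IsMatch.exists_mate {M : Finset (Sym2 V)} (h : IsMatch M) :
    ∃ μ : V → V, (∀ x ∈ cov M, s(x, μ x) ∈ M) ∧ (∀ x ∈ cov M, μ x ∈ cov M) ∧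
      (∀ x ∈ cov M, μ (μ x) = x) ∧ (∀ x ∈ cov M, μ x ≠ x) ∧
      (∀ x y, s(x, y) ∈ M → μ x = y) := by
  have key : ∀ x : V, ∃ y, x ∈ cov M → s(x, y) ∈ M := by
    intro x
    by_cases hx : x ∈ cov M
    · obtain ⟨e, he, hxe⟩ := mem_cov.1 hx
      obtain ⟨y, rfl⟩ := Sym2.mem_iff_exists.1 hxe
      exact ⟨y, fun _ => he⟩
    · exact ⟨x, fun h => absurd h hx⟩
  choose μ hμ using key
  have h5 : ∀ x y, s(x, y) ∈ M → μ x = y := by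
    intro x y hxy
    have := hμ x (mem_cov.2 ⟨_, hxy, by simp⟩)
    exact Sym2.congr_right.1 (h.disj _ this _ hxy x (by simp) (by simp))
  have h2 : ∀ x ∈ cov M, μ x ∈ cov M := fun x hx => mem_cov.2 ⟨_, hμ x hx, by simp⟩
  refine ⟨μ, fun x hx => hμ x hx, h2, ?_, ?_, h5⟩
  · intro x hx
    exact h5 _ _ (by rw [Sym2.eq_swap]; exact hμ x hx)
  · intro x hx he
    exact h.nd _ (hμ x hx) (by simp [he])

theorem IsMatch.erase_edge {M : Finset (Sym2 V)} (h : IsMatch M) (e : Sym2 V) : IsMatch (M.erase e) :=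
  h.mono (Finset.erase_subset _ _)

end Basic

/-! ### Degrees of the vertices missed by a maximum matching. -/

section Augment

variable {V : Type*} [DecidableEq V]

/-- Neighbours of uncovered vertices with respect to a maximum matching. -/
theorem nbr_subset_cov {M G : Finset (Sym2 V)} (hM : IsMatch M) (hMG : M ⊆ G)
    (hnd : ∀ e ∈ G, ¬ e.IsDiag) (hNB : NoBigger M G) {u : V} (hu : u ∉ cov M) :
    nbr G u ⊆ cov M := by
  intro x hx
  by_contra hxc
  rw [mem_nbr] at hx
  have h1 := hM.insert_edge hu hxc (by simpa using hnd _ hx)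
  have h2 := hNB _ (Finset.insert_subset hx hMG) h1
  rw [card_insert_edge hu] at h2
  omega

/-- Replace the edge `ab` of a matching by `ua`. -/
theorem IsMatch.swap {M : Finset (Sym2 V)} (hM : IsMatch M) {a b u : V} (hab : s(a, b) ∈ M)
    (hu : u ∉ cov M) :
    IsMatch (insert s(u, a) (M.erase s(a, b))) ∧
      (insert s(u, a) (M.erase s(a, b))).card = M.card ∧
      (∀ x, x ∈ cov (insert s(u, a) (M.erase s(a, b))) ↔ x = u ∨ (x ∈ cov M ∧ x ≠ b)) := by
  have ha : a ∈ cov M := mem_cov.2 ⟨_, hab, by simp⟩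
  have hne : a ≠ b := by simpa using hM.nd _ hab
  have hu' : u ∉ cov (M.erase s(a, b)) := fun h => hu ((hM.mem_cov_erase hab).1 h).1
  have ha' : a ∉ cov (M.erase s(a, b)) := fun h => ((hM.mem_cov_erase hab).1 h).2.1 rfl
  refine ⟨(hM.erase_edge _).insert_edge hu' ha' ?_, ?_, ?_⟩
  · rintro rfl; exact hu ha
  · rw [card_insert_edge hu', Finset.card_erase_of_mem hab]
    have := Finset.card_pos.2 ⟨_, hab⟩
    omega
  · intro x
    rw [cov_insert]
    simp only [Finset.mem_insert, hM.mem_cov_erase hab]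
    by_cases hxa : x = a
    · subst hxa; simp [ha, hne]
    · simp [hxa]

/-- Otherwise u, a, b, v is an augmenting path. -/
theorem mate_notMem_nbr {M G : Finset (Sym2 V)} (hM : IsMatch M) (hMG : M ⊆ G)
    (hNB : NoBigger M G) {u v a b : V} (hu : u ∉ cov M)
    (hv : v ∉ cov M) (huv : u ≠ v) (hab : s(a, b) ∈ M) (ha : a ∈ nbr G u) : b ∉ nbr G v := by
  intro hb
  rw [mem_nbr] at ha hb
  obtain ⟨h1, h2, h3⟩ := hM.swap hab hu
  have hbc : b ∈ cov M := mem_cov.2 ⟨_, hab, by simp⟩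
  have hv' : v ∉ cov (insert s(u, a) (M.erase s(a, b))) := by
    rw [h3]; rintro (h | h)
    · exact huv h.symm
    · exact hv h.1
  have hb' : b ∉ cov (insert s(u, a) (M.erase s(a, b))) := by
    rw [h3]; rintro (h | h)
    · exact hu (h ▸ hbc)
    · exact h.2 rfl
  have h4 := h1.insert_edge hv' hb' (by rintro rfl; exact hv hbc)
  have h5 := hNB _ (Finset.insert_subset hb (Finset.insert_subset ha
    ((Finset.erase_subset _ _).trans hMG))) h4
  rw [card_insert_edge hv'] at h5
  omega

/-- Two uncovered vertices have degree sum at most `2 |M|`, and if equality holds, then the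
neighbours of one of them are exactly the mates of the non-neighbours of the other. -/
theorem nbr_add_nbr {M G : Finset (Sym2 V)} (hM : IsMatch M) (hMG : M ⊆ G)
    (hnd : ∀ e ∈ G, ¬ e.IsDiag) (hNB : NoBigger M G) {u v : V} (hu : u ∉ cov M)
    (hv : v ∉ cov M) (huv : u ≠ v) :
    (nbr G u).card + (nbr G v).card ≤ 2 * M.card ∧
    ((nbr G u).card + (nbr G v).card = 2 * M.card →
      ∀ a b, s(a, b) ∈ M → a ∉ nbr G v → b ∈ nbr G u) := by
  obtain ⟨μ, h1, h2, h3, -, h5⟩ := hM.exists_mate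
  have hUs := nbr_subset_cov hM hMG hnd hNB hu
  have hVs := nbr_subset_cov hM hMG hnd hNB hv
  have hinj : Set.InjOn μ (nbr G u) := by
    intro x hx y hy hxy
    rw [← h3 x (hUs hx), ← h3 y (hUs hy), hxy]
  have hcard : ((nbr G u).image μ).card = (nbr G u).card := Finset.card_image_of_injOn hinj
  -- The mates of the neighbours of u and the neighbours of v fit disjointly into the 2|M| covered
  -- vertices; in the case of equality they partition them.
  have hdis : Disjoint ((nbr G u).image μ) (nbr G v) := by
    rw [Finset.disjoint_left]
    intro y hy hy'
    obtain ⟨x, hx, rfl⟩ := Finset.mem_image.1 hy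
    exact mate_notMem_nbr hM hMG hNB hu hv huv (h1 x (hUs hx)) hx hy'
  have hsub : (nbr G u).image μ ∪ nbr G v ⊆ cov M := by
    refine Finset.union_subset ?_ hVs
    intro y hy
    obtain ⟨x, hx, rfl⟩ := Finset.mem_image.1 hy
    exact h2 x (hUs hx)
  have hle := Finset.card_le_card hsub
  rw [Finset.card_union_of_disjoint hdis, hcard, hM.card_cov] at hle
  refine ⟨hle, fun heq a b hab ha => ?_⟩
  have hEq : (nbr G u).image μ ∪ nbr G v = cov M := by
    apply Finset.eq_of_subset_of_card_le hsub
    rw [Finset.card_union_of_disjoint hdis, hcard, hM.card_cov, heq]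
  have hac : a ∈ cov M := mem_cov.2 ⟨_, hab, by simp⟩
  rw [← hEq] at hac
  rcases Finset.mem_union.1 hac with h | h
  · obtain ⟨x, hx, rfl⟩ := Finset.mem_image.1 h
    have := h3 x (hUs hx)
    rw [h5 _ _ hab] at this
    rwa [this]
  · exact absurd h ha

end Augment

/-! ### Representing graphs and private colors. -/

section Rainbow

variable {V K : Type*} [DecidableEq V] [DecidableEq K]

theorem card_colors_eq {c : Sym2 V → K} {W : Finset V} {G : Finset (Sym2 V)} (h : IsRep c W G) :
    (colors c W).card = G.card := by
  rw [← h.img, Finset.card_image_of_injOn h.inj]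

theorem mem_colors {c : Sym2 V → K} {W : Finset V} {x y : V} (hx : x ∈ W) (hy : y ∈ W)
    (hxy : x ≠ y) : c s(x, y) ∈ colors c W :=
  Finset.mem_image_of_mem _ (mk_mem_pairs.2 ⟨hx, hy, hxy⟩)

theorem colors_mono (c : Sym2 V → K) {W W' : Finset V} (h : W ⊆ W') :
    colors c W ⊆ colors c W' :=
  Finset.image_subset_image (pairs_mono h)

theorem card_colors_le (c : Sym2 V → K) (W : Finset V) :
    (colors c W).card ≤ W.card.choose 2 := by
  rw [← card_pairs]; exact Finset.card_image_le

/-- Add to M one edge of each color that it lacks. -/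
theorem exists_isRep (c : Sym2 V → K) (W : Finset V) {M : Finset (Sym2 V)} (hM : M ⊆ pairs W)
    (hinj : Set.InjOn c M) : ∃ G, M ⊆ G ∧ IsRep c W G := by
  have hs : Set.SurjOn c ((pairs W).filter fun e => c e ∉ M.image c : Finset (Sym2 V))
      (colors c W \ M.image c : Finset K) := by
    intro κ hκ
    rw [Finset.mem_coe, Finset.mem_sdiff] at hκ
    obtain ⟨e, he, rfl⟩ := Finset.mem_image.1 hκ.1
    exact ⟨e, by simpa [he] using hκ.2, rfl⟩
  obtain ⟨F, hF, hFi, hFimg⟩ := Finset.exists_subset_injOn_image_eq_of_surjOn _ _ hs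
  refine ⟨M ∪ F, Finset.subset_union_left, ⟨?_, ?_, ?_⟩⟩
  · exact Finset.union_subset hM (fun e he => (Finset.mem_filter.1 (hF he)).1)
  · have hx : ∀ e ∈ M, ∀ f ∈ F, c e ≠ c f := by
      intro e he f hf h
      exact (Finset.mem_filter.1 (hF hf)).2 (h ▸ Finset.mem_image_of_mem _ he)
    intro e he f hf h
    rw [Finset.mem_coe, Finset.mem_union] at he hf
    rcases he with he | he <;> rcases hf with hf | hf
    · exact hinj he hf h
    · exact absurd h (hx e he f hf)
    · exact absurd h.symm (hx f hf e he)
    · exact hFi he hf h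
  · rw [Finset.image_union, hFimg, Finset.union_sdiff_of_subset]
    exact Finset.image_subset_image hM

/-- Every matching inside a representing graph is rainbow, so augmenting-path arguments apply to
rainbow matchings. -/
theorem IsRep.noBigger {c : Sym2 V → K} {W : Finset V} {G M : Finset (Sym2 V)} (h : IsRep c W G)
    (hno : ¬ HasRM c W (M.card + 1)) : NoBigger M G := by
  intro M' hM' hm
  by_contra hlt
  obtain ⟨M₂, h2, h3⟩ := Finset.exists_subset_card_eq (show M.card + 1 ≤ M'.card by omega)
  exact hno ⟨M₂, (h2.trans hM').trans h.sub, hm.mono h2, h.inj.mono (h2.trans hM'), h3⟩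

theorem HasRM.mono {c : Sym2 V → K} {W W' : Finset V} {s : ℕ} (h : HasRM c W s) (hW : W ⊆ W') :
    HasRM c W' s := by
  obtain ⟨M, h1, h2⟩ := h
  exact ⟨M, h1.trans (pairs_mono hW), h2⟩

theorem HasRM.le {c : Sym2 V → K} {W : Finset V} {s t : ℕ} (h : HasRM c W s) (ht : t ≤ s) :
    HasRM c W t := by
  obtain ⟨M, h1, h2, h3, h4⟩ := h
  obtain ⟨M₂, h5, h6⟩ := Finset.exists_subset_card_eq (h4 ▸ ht)
  exact ⟨M₂, h5.trans h1, h2.mono h5, h3.mono h5, h6⟩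

/-- Adding an edge of a new color to a rainbow matching. -/
theorem rainbow_insert {c : Sym2 V → K} {M : Finset (Sym2 V)} {e : Sym2 V}
    (h : Set.InjOn c M) (he : c e ∉ M.image c) : Set.InjOn c (insert e M : Finset (Sym2 V)) := by
  rw [Finset.coe_insert]
  intro f hf g hg hfg
  rcases hf with rfl | hf <;> rcases hg with rfl | hg
  · rfl
  · exact absurd (hfg ▸ Finset.mem_image_of_mem c hg) he
  · exact absurd (hfg ▸ Finset.mem_image_of_mem c hf) he
  · exact h hf hg hfg

theorem HasRM.insert_edge {c : Sym2 V → K} {W W' : Finset V} {M : Finset (Sym2 V)} {x y : V}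
    (hM : M ⊆ pairs W) (hm : IsMatch M) (hi : Set.InjOn c M) (hW : W ⊆ W') (hxW : x ∈ W')
    (hyW : y ∈ W') (hx : x ∉ cov M) (hy : y ∉ cov M) (hxy : x ≠ y) (hc : c s(x, y) ∉ M.image c) :
    HasRM c W' (M.card + 1) :=
  ⟨insert s(x, y) M, Finset.insert_subset (mk_mem_pairs.2 ⟨hxW, hyW, hxy⟩)
    (hM.trans (pairs_mono hW)), hm.insert_edge hx hy hxy, rainbow_insert hi hc,
    card_insert_edge hx⟩

/-- If `x` has a private color, then some representing edge `xy` of a private color can be removed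
together with both ends, which limits the number of colors. -/
theorem exists_private_nbr {c : Sym2 V → K} {W : Finset V} {G : Finset (Sym2 V)}
    (hG : IsRep c W G) {x : V} (hx : x ∈ W) {s : ℕ} (hno : ¬ HasRM c W (s + 1))
    (hp : colors c (W.erase x) ≠ colors c W) :
    ∃ y ∈ W, y ≠ x ∧ s(x, y) ∈ G ∧
      (colors c W).card + 1 ≤ (colors c ((W.erase x).erase y)).card +
        ((nbr G x).card + (nbr G y).card) ∧ ¬ HasRM c ((W.erase x).erase y) s := by
  have hsub := colors_mono c (Finset.erase_subset x W)
  -- This color lives only on edges at x, so its representative has the form xy.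
  obtain ⟨κ, hκ, hκ'⟩ : ∃ κ ∈ colors c W, κ ∉ colors c (W.erase x) := by
    by_contra h
    push Not at h
    exact hp (Finset.Subset.antisymm hsub h)
  rw [← hG.img] at hκ
  obtain ⟨e, he, rfl⟩ := Finset.mem_image.1 hκ
  have hxe : x ∈ e := by
    by_contra hxe
    apply hκ'
    refine Finset.mem_image_of_mem _ ?_
    have := hG.sub he
    revert this hxe
    induction e with
    | _ a b => simp only [Sym2.mem_iff, mk_mem_pairs, Finset.mem_erase]; tauto
  obtain ⟨y, rfl⟩ := Sym2.mem_iff_exists.1 hxe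
  obtain ⟨-, hyW, hxy⟩ := mk_mem_pairs.1 (hG.sub he)
  refine ⟨y, hyW, hxy.symm, he, ?_, ?_⟩
  · rw [card_colors_eq hG]
    have h1 : G ⊆ (G.filter (x ∈ ·)) ∪ ((G.filter (y ∈ ·)).erase s(x, y)) ∪
        G.filter (· ∈ pairs ((W.erase x).erase y)) := by
      intro f hf
      have hfW := hG.sub hf
      simp only [Finset.mem_union, Finset.mem_filter, Finset.mem_erase]
      revert hf hfW
      induction f with
      | _ a b =>
        intro hf hfW
        simp only [mk_mem_pairs, Finset.mem_erase] at hfW ⊢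
        by_cases h1 : x ∈ s(a, b)
        · exact Or.inl (Or.inl ⟨hf, h1⟩)
        by_cases h2 : y ∈ s(a, b)
        · refine Or.inl (Or.inr ⟨?_, hf, h2⟩)
          intro h; rw [h] at h1; simp at h1
        · simp only [Sym2.mem_iff, not_or] at h1 h2
          exact Or.inr ⟨hf, ⟨Ne.symm h2.1, Ne.symm h1.1, hfW.1⟩,
            ⟨Ne.symm h2.2, Ne.symm h1.2, hfW.2.1⟩, hfW.2.2⟩
    have h2 := Finset.card_le_card h1
    have h3 := (Finset.card_union_le _ _).trans' h2
    have h4 := Finset.card_union_le (G.filter (x ∈ ·)) ((G.filter (y ∈ ·)).erase s(x, y))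
    have h5 : s(x, y) ∈ G.filter (y ∈ ·) := by simp [he]
    have h6 := Finset.card_pos.2 ⟨_, h5⟩
    rw [Finset.card_erase_of_mem h5] at h4
    rw [card_filter_mem, card_filter_mem] at h4
    rw [card_filter_mem] at h6
    have h7 : (G.filter (· ∈ pairs ((W.erase x).erase y))).card ≤
        (colors c ((W.erase x).erase y)).card := by
      rw [← Finset.card_image_of_injOn (hG.inj.mono (Finset.filter_subset _ _))]
      refine Finset.card_le_card (Finset.image_subset_image ?_)
      intro f hf
      exact (Finset.mem_filter.1 hf).2
    omega
  -- The private color does not occur away from x, so xy extends every rainbow matching of the rest.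
  · rintro ⟨M, h1, h2, h3, rfl⟩
    have hc := cov_subset h1
    refine hno (HasRM.insert_edge h1 h2 h3
      ((Finset.erase_subset _ _).trans (Finset.erase_subset _ _)) hx hyW ?_ ?_ hxy ?_)
    · intro h; have := hc h; simp at this
    · intro h; have := hc h; simp at this
    · intro h
      apply hκ'
      exact (colors_mono c (Finset.erase_subset _ _)) ((Finset.image_subset_image h1) h)

end Rainbow

theorem two_mul_choose_two (n : ℕ) : 2 * n.choose 2 + n = n * n := by
  induction n with
  | zero => simp
  | succ n ih => rw [Nat.choose_succ_succ' n 1, Nat.choose_one_right]; nlinarith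

/-! ### Perfect matchings in nearly complete graphs. -/

section Perfect

variable {V : Type*} [DecidableEq V]

theorem exists_max_match (G : Finset (Sym2 V)) : ∃ M ⊆ G, IsMatch M ∧ NoBigger M G := by
  classical
  obtain ⟨M, hM, hmax⟩ := Finset.exists_max_image (G.powerset.filter IsMatch) Finset.card
    ⟨∅, by simp only [Finset.mem_filter, Finset.empty_mem_powerset, true_and]
           exact ⟨by simp, by simp⟩⟩
  simp only [Finset.mem_filter, Finset.mem_powerset] at hM hmax
  exact ⟨M, hM.1, hM.2, fun M' h1 h2 => hmax M' ⟨h1, h2⟩⟩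

theorem NoBigger.of_card_eq {M M' G : Finset (Sym2 V)} (h : NoBigger M G) (h' : M'.card = M.card) :
    NoBigger M' G := fun N h1 h2 => h' ▸ h N h1 h2

/-- A graph on `2q` vertices without isolated vertices that misses at most `4q - 7` edges has a
perfect matching. -/
theorem exists_perfect {H : Finset (Sym2 V)} {U : Finset V} {q : ℕ} (hH : H ⊆ pairs U)
    (hU : U.card = 2 * q) (hiso : ∀ x ∈ U, (nbr H x).Nonempty)
    (hbig : (2 * q).choose 2 + 7 ≤ H.card + 4 * q) : ∃ M ⊆ H, IsMatch M ∧ M.card = q := by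
  obtain ⟨M, hMH, hM, hNB⟩ := exists_max_match H
  by_cases hq : q ≤ M.card
  · obtain ⟨M', h1, h2⟩ := Finset.exists_subset_card_eq hq
    exact ⟨M', h1.trans hMH, hM.mono h1, h2⟩
  exfalso
  push Not at hq
  have hnd : ∀ e ∈ H, ¬ e.IsDiag := fun e he => not_isDiag_of_mem_pairs (hH he)
  have hcU : cov M ⊆ U := cov_subset (hMH.trans hH)
  have hcard : 1 < (U \ cov M).card := by
    rw [Finset.card_sdiff_of_subset hcU, hM.card_cov]; omega
  obtain ⟨x, hx, y, hy, hxy⟩ := Finset.one_lt_card.1 hcard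
  rw [Finset.mem_sdiff] at hx hy
  have hxyd := (nbr_add_nbr hM hMH hnd hNB hx.2 hy.2 hxy).1
  have hNx := nbr_subset_cov hM hMH hnd hNB hx.2
  have hNy := nbr_subset_cov hM hMH hnd hNB hy.2
  obtain ⟨μ, m1, m2, m3, m4, m5⟩ := hM.exists_mate
  have htc := two_mul_choose_two (2 * q)
  -- With distinct neighbours a of x and b of y, swapping in xa and yb uncovers the mates of a and b
  -- instead. Both pairs have degree sum at most 2(q − 1), so at least (8q − 10) − 4(q − 1) = 4q − 6
  -- edges are missing.
  by_cases hsep : ∃ a ∈ nbr H x, ∃ b ∈ nbr H y, b ≠ a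
  · obtain ⟨a, ha, b, hb, hba⟩ := hsep
    have hac := hNx ha
    have hbc := hNy hb
    have hbμ : b ≠ μ a := by
      rintro rfl
      exact mate_notMem_nbr hM hMH hNB hx.2 hy.2 hxy (m1 a hac) ha hb
    obtain ⟨s1, s2, s3⟩ := hM.swap (m1 a hac) hx.2
    set M1 := insert s(x, a) (M.erase s(a, μ a)) with hM1
    have hM1H : M1 ⊆ H := Finset.insert_subset (mem_nbr.1 ha) ((Finset.erase_subset _ _).trans hMH)
    have hbM1 : s(b, μ b) ∈ M1 := by
      refine Finset.mem_insert_of_mem (Finset.mem_erase.2 ⟨?_, m1 b hbc⟩)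
      intro h
      have : b ∈ s(a, μ a) := h ▸ Sym2.mem_mk_left b _
      rcases Sym2.mem_iff.1 this with h | h
      · exact hba h
      · exact hbμ h
    have hyM1 : y ∉ cov M1 := by
      rw [s3]; rintro (h | h)
      · exact hxy h.symm
      · exact hy.2 h.1
    obtain ⟨t1, t2, t3⟩ := s1.swap hbM1 hyM1
    set M2 := insert s(y, b) (M1.erase s(b, μ b)) with hM2
    have hM2H : M2 ⊆ H := Finset.insert_subset (mem_nbr.1 hb) ((Finset.erase_subset _ _).trans hM1H)
    have hμa : μ a ∈ cov M := m2 a hac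
    have hμb : μ b ∈ cov M := m2 b hbc
    have hab : μ a ≠ μ b := fun h => hba (by rw [← m3 a hac, ← m3 b hbc, h])
    have hxa : x ≠ μ a := fun h => hx.2 (h ▸ hμa)
    have hxb : x ≠ μ b := fun h => hx.2 (h ▸ hμb)
    have hya : y ≠ μ a := fun h => hy.2 (h ▸ hμa)
    have hyb : y ≠ μ b := fun h => hy.2 (h ▸ hμb)
    have hd := (nbr_add_nbr t1 hM2H hnd (hNB.of_card_eq (t2.trans s2)) (u := μ a) (v := μ b)
      (by rw [t3, s3]; rintro (h | ⟨h | h, -⟩)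
          · exact hya h.symm
          · exact hxa h.symm
          · exact h.2 rfl)
      (by rw [t3, s3]; rintro (h | ⟨-, h⟩)
          · exact hyb h.symm
          · exact h rfl) hab).1
    rw [t2, s2] at hd
    have hsum := card_le_sum_nbr_add (S := {x, y, μ a, μ b}) hH
    rw [Finset.sum_insert (by simp [hxy, hxa, hxb]), Finset.sum_insert (by simp [hya, hyb]),
      Finset.sum_pair hab] at hsum
    have hS : ({x, y, μ a, μ b} : Finset V).card = 4 := by
      rw [Finset.card_insert_of_notMem (by simp [hxy, hxa, hxb]),
        Finset.card_insert_of_notMem (by simp [hya, hyb]), Finset.card_pair hab]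
    have hSU : ({x, y, μ a, μ b} : Finset V) ⊆ U := by
      intro z hz
      simp only [Finset.mem_insert, Finset.mem_singleton] at hz
      rcases hz with rfl | rfl | rfl | rfl
      · exact hx.1
      · exact hy.1
      · exact hcU hμa
      · exact hcU hμb
    rw [Finset.card_sdiff_of_subset hSU, hS, hU] at hsum
    have h4 := Finset.card_le_card hSU
    rw [hS, hU] at h4
    obtain ⟨j, rfl⟩ : ∃ j, q = j + 2 := ⟨q - 2, by omega⟩
    have := two_mul_choose_two (2 * (j + 2) - 4)
    rw [show 2 * (j + 2) - 4 = 2 * j by omega] at *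
    nlinarith
  · push Not at hsep
    obtain ⟨a, ha⟩ := hiso x hx.1
    obtain ⟨b, hb⟩ := hiso y hy.1
    have hab := hsep a ha b hb
    subst hab
    -- Here x and y have the same single neighbour, so at least (4q − 3) − 2 = 4q − 5 edges are
    -- missing.
    have hX : (nbr H x).card ≤ 1 := Finset.card_le_one.2 fun p hp r hr =>
      (hsep p hp b hb).symm.trans (hsep r hr b hb)
    have hY : (nbr H y).card ≤ 1 := Finset.card_le_one.2 fun p hp r hr =>
      (hsep b ha p hp).trans (hsep b ha r hr).symm
    have hsum := card_le_sum_nbr_add (S := {x, y}) hH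
    have hSU : ({x, y} : Finset V) ⊆ U := by
      intro z hz
      simp only [Finset.mem_insert, Finset.mem_singleton] at hz
      rcases hz with rfl | rfl
      · exact hx.1
      · exact hy.1
    rw [Finset.sum_pair hxy, Finset.card_sdiff_of_subset hSU, hU, Finset.card_pair hxy] at hsum
    obtain ⟨j, rfl⟩ : ∃ j, q = j + 1 := ⟨q - 1, by omega⟩
    have := two_mul_choose_two (2 * (j + 1) - 2)
    rw [show 2 * (j + 1) - 2 = 2 * j by omega] at *
    nlinarith

end Perfect

/-- `m` exceeds by two the maximum size of a graph on `n` vertices without `σ + 1` disjoint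
edges. -/
def Big (σ n m : ℕ) : Prop :=
  σ * (2 * σ + 1) + 2 ≤ m ∧ 2 * σ * n + 4 ≤ 2 * m + σ * (σ + 1)

theorem Big.of_succ {σ n m : ℕ} (h : Big (σ + 1) n m) (hn : σ + 1 ≤ n) : Big σ n m := by
  obtain ⟨h1, h2⟩ := h
  constructor <;> nlinarith

/-! ### Rainbow matchings on at least 2σ + 5 vertices. -/

section Rainbow

variable {V K : Type*} [DecidableEq V] [DecidableEq K]

/-- Exchange an edge of a rainbow matching for a disjoint edge of the same color. -/
theorem exchange {c : Sym2 V → K} {W : Finset V} {M : Finset (Sym2 V)} (hW : M ⊆ pairs W)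
    (hM : IsMatch M) (hi : Set.InjOn c M) {a b x y : V} (hab : s(a, b) ∈ M)
    (hc : c s(x, y) = c s(a, b)) (hx : x ∈ W) (hy : y ∈ W) (hxM : x ∉ cov M) (hyM : y ∉ cov M)
    (hxy : x ≠ y) :
    ∃ M', M' = insert s(x, y) (M.erase s(a, b)) ∧ M' ⊆ pairs W ∧ IsMatch M' ∧ Set.InjOn c M' ∧
      M'.card = M.card ∧ M'.image c = M.image c ∧
      ∀ z, z ∈ cov M' ↔ z = x ∨ z = y ∨ (z ∈ cov M ∧ z ≠ a ∧ z ≠ b) := by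
  have hx' : x ∉ cov (M.erase s(a, b)) := fun h => hxM ((hM.mem_cov_erase hab).1 h).1
  have hy' : y ∉ cov (M.erase s(a, b)) := fun h => hyM ((hM.mem_cov_erase hab).1 h).1
  refine ⟨_, rfl, ?_, (hM.erase_edge _).insert_edge hx' hy' hxy, ?_, ?_, ?_, ?_⟩
  · exact Finset.insert_subset (mk_mem_pairs.2 ⟨hx, hy, hxy⟩) ((Finset.erase_subset _ _).trans hW)
  · refine rainbow_insert (hi.mono (Finset.coe_subset.2 (Finset.erase_subset _ _))) ?_
    rw [hc]
    intro h
    obtain ⟨e, he, hce⟩ := Finset.mem_image.1 h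
    obtain ⟨hne, heM⟩ := Finset.mem_erase.1 he
    exact hne (hi heM hab hce)
  · rw [card_insert_edge hx', Finset.card_erase_of_mem hab]
    have := Finset.card_pos.2 ⟨_, hab⟩
    omega
  · rw [Finset.image_insert, hc, ← Finset.image_insert, Finset.insert_erase hab]
  · intro z
    rw [cov_insert]
    simp [hM.mem_cov_erase hab]

/-- An edge between uncovered vertices with a new color would enlarge M. -/
theorem exists_color_eq {c : Sym2 V → K} {W : Finset V} {M : Finset (Sym2 V)} (hW : M ⊆ pairs W)
    (hM : IsMatch M) (hi : Set.InjOn c M) (hno : ¬ HasRM c W (M.card + 1)) {x y : V}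
    (hx : x ∈ W) (hy : y ∈ W) (hxM : x ∉ cov M) (hyM : y ∉ cov M) (hxy : x ≠ y) :
    ∃ a b, s(a, b) ∈ M ∧ c s(x, y) = c s(a, b) := by
  by_contra h
  push Not at h
  refine hno (HasRM.insert_edge hW hM hi subset_rfl hx hy hxM hyM hxy ?_)
  intro h'
  obtain ⟨e, he, hce⟩ := Finset.mem_image.1 h'
  revert he hce
  induction e with
  | _ a b => exact fun he hce => h a b he hce.symm

theorem notMem_image_of_mem_rep {c : Sym2 V → K} {W : Finset V} {M G : Finset (Sym2 V)}
    (hG : IsRep c W G) (hMG : M ⊆ G) {x y : V} (hx : x ∉ cov M) (hxy : s(x, y) ∈ G) :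
    c s(x, y) ∉ M.image c := by
  intro h
  obtain ⟨e, he, hce⟩ := Finset.mem_image.1 h
  have := hG.inj (hMG he) hxy hce
  rw [this] at he
  exact notMem_of_notMem_cov hx he

/-- Two disjoint edges of different colors. -/
theorem hasRM_two {c : Sym2 V → K} {W : Finset V} (hW : 5 ≤ W.card)
    (hm : 2 ≤ (colors c W).card) : HasRM c W 2 := by
  obtain ⟨κ, hκ, κ', hκ', hne⟩ := Finset.one_lt_card.1 (by omega : 1 < (colors c W).card)
  obtain ⟨e, he, rfl⟩ := Finset.mem_image.1 hκ
  obtain ⟨f, hf, rfl⟩ := Finset.mem_image.1 hκ'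
  have key : ∀ e ∈ pairs W, ∀ f ∈ pairs W, (∀ x, x ∈ e → x ∉ f) → c e ≠ c f → HasRM c W 2 := by
    intro e he f hf hd hcef
    have hef : e ≠ f := fun h => hcef (by rw [h])
    refine ⟨{e, f}, ?_, ⟨?_, ?_⟩, ?_, Finset.card_pair hef⟩
    · intro g hg
      rcases Finset.mem_insert.1 hg with rfl | hg
      · exact he
      · rw [Finset.mem_singleton.1 hg]; exact hf
    · intro g hg
      rcases Finset.mem_insert.1 hg with rfl | hg
      · exact not_isDiag_of_mem_pairs he
      · rw [Finset.mem_singleton.1 hg]; exact not_isDiag_of_mem_pairs hf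
    · intro g hg g' hg' x hx hx'
      simp only [Finset.mem_insert, Finset.mem_singleton] at hg hg'
      rcases hg with rfl | rfl <;> rcases hg' with rfl | rfl
      · rfl
      · exact absurd hx' (hd x hx)
      · exact absurd hx (hd x hx')
      · rfl
    · intro g hg g' hg' h
      simp only [Finset.coe_insert, Finset.coe_singleton, Set.mem_insert_iff,
        Set.mem_singleton_iff] at hg hg'
      rcases hg with rfl | rfl <;> rcases hg' with rfl | rfl
      · rfl
      · exact absurd h hcef
      · exact absurd h.symm hcef
      · rfl
  by_cases hd : ∀ x, x ∈ e → x ∉ f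
  · exact key e he f hf hd hne
  push Not at hd
  obtain ⟨x, hxe, hxf⟩ := hd
  obtain ⟨y, rfl⟩ := Sym2.mem_iff_exists.1 hxe
  obtain ⟨z, rfl⟩ := Sym2.mem_iff_exists.1 hxf
  -- An edge disjoint from both xy and xz differs in color from at least one of them.
  have hcard : 1 < (W \ {x, y, z}).card := by
    have h1 := Finset.le_card_sdiff ({x, y, z} : Finset V) W
    have h2 : ({x, y, z} : Finset V).card ≤ 3 := Finset.card_le_three
    omega
  obtain ⟨p, hp, q, hq, hpq⟩ := Finset.one_lt_card.1 hcard
  simp only [Finset.mem_sdiff, Finset.mem_insert, Finset.mem_singleton, not_or] at hp hq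
  have hg : s(p, q) ∈ pairs W := mk_mem_pairs.2 ⟨hp.1, hq.1, hpq⟩
  by_cases h : c s(x, y) = c s(p, q)
  · refine key _ hf _ hg ?_ (fun h' => hne (h.trans h'.symm))
    intro w hw; simp only [Sym2.mem_iff] at hw ⊢; rcases hw with rfl | rfl <;> tauto
  · refine key _ he _ hg ?_ h
    intro w hw; simp only [Sym2.mem_iff] at hw ⊢; rcases hw with rfl | rfl <;> tauto

/-- On `n ≥ 2σ + 5` vertices, `Big` many colors force a rainbow matching with `σ + 2` edges. -/
def MatchingBound (c : Sym2 V → K) (σ : ℕ) : Prop :=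
  ∀ W : Finset V, 2 * σ + 5 ≤ W.card → Big σ W.card (colors c W).card → HasRM c W (σ + 2)

theorem matchingBound_zero (c : Sym2 V → K) : MatchingBound c 0 :=
  fun _ hW hb => hasRM_two (by omega) (by have := hb.1; omega)

/-- Here d and n − 1 bound the degrees of the two ends of a private edge. If d ≤ σ + 1, the star
term of `Big` passes exactly from (σ + 1, n) to (σ, n − 2). -/
theorem deg_lower_bound {σ n m m' d : ℕ} (hb : Big (σ + 1) n m) (hn : 2 * σ + 7 ≤ n)
    (h : ¬ Big σ (n - 2) m') (hd : m + 1 ≤ m' + (d + (n - 1))) : σ + 2 ≤ d := by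
  by_contra hlt
  push Not at hlt
  obtain ⟨h1, h2⟩ := hb
  obtain ⟨j, rfl⟩ : ∃ j, n = j + 2 := ⟨n - 2, by omega⟩
  simp only [Nat.add_sub_cancel, show j + 2 - 1 = j + 1 by omega] at *
  have hA : 2 * m' + σ * (σ + 1) ≤ 2 * σ * j + 3 → False := by
    intro h
    nlinarith
  by_cases hB : σ * (2 * σ + 1) + 2 ≤ m'
  · refine hA ?_
    by_contra h4
    exact h ⟨hB, by omega⟩
  -- If only the clique term fails for m', then either j is large and the star term dominates it, or
  -- m − m' ≥ 4σ + 4 exceeds the at most σ + 1 + j colors lost.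
  · by_cases h3 : 3 * σ + 3 ≤ j
    · refine hA ?_
      nlinarith
    · nlinarith

/-- Vertices without private color are deleted until the order is 2σ + 7, where `hE` takes over.
Otherwise the minimum degree is at least σ + 2, so the degree sum bound is attained by any two of
the three or more uncovered vertices. -/
theorem matchingBound_succ {c : Sym2 V → K} {σ : ℕ} (hT : MatchingBound c σ)
    (hE : ∀ W : Finset V, W.card = 2 * σ + 7 → Big (σ + 1) W.card (colors c W).card →
      (∃ u ∈ W, colors c (W.erase u) = colors c W) → HasRM c W (σ + 3)) :
    MatchingBound c (σ + 1) := by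
  intro W
  induction hn : W.card using Nat.strong_induction_on generalizing W with
  | _ n ih =>
  subst hn
  intro hW hb
  by_contra hno
  by_cases hpz : ∃ u ∈ W, colors c (W.erase u) = colors c W
  · by_cases hW7 : W.card = 2 * σ + 7
    · exact hno (hE W hW7 hb hpz)
    obtain ⟨u, hu, hcu⟩ := hpz
    have hcard := Finset.card_erase_of_mem hu
    refine hno ((ih _ (by omega) (W.erase u) rfl (by omega) ?_).mono (Finset.erase_subset _ _))
    rw [hcu, hcard]
    obtain ⟨h1, h2⟩ := hb
    refine ⟨h1, ?_⟩
    have : 2 * (σ + 1) * (W.card - 1) ≤ 2 * (σ + 1) * W.card := Nat.mul_le_mul_left _ (by omega)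
    omega
  push Not at hpz
  obtain ⟨M, hMW, hM, hi, hMc⟩ := hT W (by omega) (hb.of_succ (by omega))
  have hno' : ¬ HasRM c W (M.card + 1) := by rw [hMc]; exact hno
  obtain ⟨G, hMG, hG⟩ := exists_isRep c W hMW hi
  have hNB := hG.noBigger hno'
  have hnd : ∀ e ∈ G, ¬ e.IsDiag := fun e he => not_isDiag_of_mem_pairs (hG.sub he)
  have hZ : 2 < (W \ cov M).card := by
    rw [Finset.card_sdiff_of_subset (cov_subset hMW), hM.card_cov]; omega
  obtain ⟨z1, z2, z3, hz1, hz2, hz3, h12, h13, h23⟩ := Finset.two_lt_card_iff.1 hZ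
  rw [Finset.mem_sdiff] at hz1 hz2 hz3
  have hdeg : ∀ z ∈ W, σ + 2 ≤ (nbr G z).card := by
    intro z hz
    obtain ⟨y, hy, hyz, -, hm, hnr⟩ := exists_private_nbr hG hz (s := σ + 2) hno (hpz z hz)
    have hcard : ((W.erase z).erase y).card = W.card - 2 := by
      rw [Finset.card_erase_of_mem (Finset.mem_erase.2 ⟨hyz, hy⟩), Finset.card_erase_of_mem hz]
      omega
    have hnb : ¬ Big σ (W.card - 2) (colors c ((W.erase z).erase y)).card := by
      rw [← hcard]
      exact fun h => hnr (hT _ (by omega) h)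
    have := card_nbr_lt hG.sub hy
    exact deg_lower_bound hb (by omega) hnb (by omega)
  have d1 := hdeg z1 hz1.1
  have d2 := hdeg z2 hz2.1
  have d3 := hdeg z3 hz3.1
  obtain ⟨e12, -⟩ := nbr_add_nbr hM hMG hnd hNB hz1.2 hz2.2 h12
  obtain ⟨e13, f13⟩ := nbr_add_nbr hM hMG hnd hNB hz1.2 hz3.2 h13
  obtain ⟨e23, f23⟩ := nbr_add_nbr hM hMG hnd hNB hz2.2 hz3.2 h23
  obtain ⟨a, b, hab, hcab⟩ := exists_color_eq hMW hM hi hno' hz1.1 hz2.1 hz1.2 hz2.2 h12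
  -- Replacing pq by z1 z2 keeps the colors of M and frees p; an edge z3 p of G would then enlarge
  -- the rainbow matching.
  have hz3n : ∀ p q, s(p, q) ∈ M → c s(z1, z2) = c s(p, q) → p ∉ nbr G z3 := by
    intro p q hpq hcpq hp
    obtain ⟨M', -, i1, i2, i3, i4, i5, i6⟩ :=
      exchange hMW hM hi hpq hcpq hz1.1 hz2.1 hz1.2 hz2.2 h12
    have hpc : p ∈ cov M := mem_cov.2 ⟨_, hpq, by simp⟩
    refine hno' ?_
    rw [← i4]
    refine HasRM.insert_edge i1 i2 i3 subset_rfl hz3.1 (cov_subset hMW hpc) (y := p) ?_ ?_ ?_ ?_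
    · rw [i6]; rintro (h | h | h)
      · exact h13 h.symm
      · exact h23 h.symm
      · exact hz3.2 h.1
    · rw [i6]; rintro (h | h | h)
      · exact hz1.2 (h ▸ hpc)
      · exact hz2.2 (h ▸ hpc)
      · exact h.2.1 rfl
    · rintro rfl; exact hz3.2 hpc
    · rw [i5]; exact notMem_image_of_mem_rep hG hMG hz3.2 (mem_nbr.1 hp)
  have ha := hz3n a b hab hcab
  have hb' := hz3n b a (by rwa [Sym2.eq_swap]) (by rw [hcab, Sym2.eq_swap])
  -- Since z3 misses both a and b, tightness makes b a neighbour of z2 and a one of z1: an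
  -- augmenting path.
  have h1 := f23 (by omega) a b hab ha
  have h2 := f13 (by omega) b a (by rwa [Sym2.eq_swap]) hb'
  exact mate_notMem_nbr hM hMG hNB hz1.2 hz2.2 h12 hab h2 h1

end Rainbow

/-! ### Seven colors on six vertices. -/

section Six

variable {V K : Type*} [DecidableEq V] [DecidableEq K]

/-- At most one coincidence is possible, and of two equal values one has an index different from 0
and 1; that index is dropped. -/
theorem exists_ne_of_seven_le_card {f : Fin 8 → K} (h01 : f 0 ≠ f 1)
    (h : 7 ≤ (Finset.univ.image f).card) :
    ∃ j : Fin 8, 2 ≤ j ∧ ∀ a b, a ≠ b → a ≠ j → b ≠ j → f a ≠ f b := by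
  by_cases hinj : Function.Injective f
  · exact ⟨2, le_rfl, fun a b hab _ _ he => hab (hinj he)⟩
  have key : ∀ a j, a ≠ j → f a = f j → ∀ x y, x ≠ y → x ≠ j → y ≠ j → f x ≠ f y := by
    intro a j haj hf x y hxy hx hy hfx
    have himg : Finset.univ.image f = (Finset.univ.erase j).image f := by
      refine Finset.Subset.antisymm ?_ (Finset.image_subset_image (Finset.erase_subset _ _))
      intro κ hκ
      obtain ⟨i, -, rfl⟩ := Finset.mem_image.1 hκ
      by_cases hij : i = j
      · subst hij; rw [← hf]; exact Finset.mem_image_of_mem _ (by simp [haj])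
      · exact Finset.mem_image_of_mem _ (by simp [hij])
    rw [himg] at h
    have hc : (Finset.univ.erase j).card = 7 := by simp
    have := Finset.card_image_iff.1 (le_antisymm Finset.card_image_le (hc ▸ h))
    exact hxy (this (by simp [hx]) (by simp [hy]) hfx)
  simp only [Function.Injective, not_forall] at hinj
  obtain ⟨a, b, hf, hab⟩ := hinj
  by_cases ha : 2 ≤ a
  · exact ⟨a, ha, key b a (Ne.symm hab) hf.symm⟩
  by_cases hb : 2 ≤ b
  · exact ⟨b, hb, key a b hab hf⟩
  exfalso
  have : (a = 0 ∧ b = 1) ∨ (a = 1 ∧ b = 0) := by omega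
  rcases this with ⟨rfl, rfl⟩ | ⟨rfl, rfl⟩
  · exact h01 hf
  · exact h01 hf.symm

/-- If a matching with colors f, g, t is not rainbow, then f and g contribute at most one color
besides t. -/
theorem exists_slot {f g t : K} (h : f = g ∨ f = t ∨ g = t) :
    ∃ κ, (f = κ ∨ f = t) ∧ (g = κ ∨ g = t) ∧ (f = κ ∨ g = κ) := by
  rcases h with h | h | h
  · exact ⟨f, Or.inl rfl, Or.inl h.symm, Or.inl rfl⟩
  · exact ⟨g, Or.inr h, Or.inl rfl, Or.inr rfl⟩
  · exact ⟨f, Or.inl rfl, Or.inr h, Or.inl rfl⟩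

/-- Six perfect matchings contain exactly one of the edges 01, 23, 45. Each contributes at most one
color besides the two on these edges, so at most eight candidates cover all colors, and with seven
colors all but one of them are pairwise distinct. This leaves a finite check. -/
theorem not_seven_colors (d : Fin 6 → Fin 6 → K) (hs : ∀ i j, d i j = d j i)
    (hPM : ∀ a b p q x y : Fin 6, [a, b, p, q, x, y].Nodup →
      d a b = d p q ∨ d a b = d x y ∨ d p q = d x y) (h1 : d 0 1 = d 2 3) (h2 : d 2 3 ≠ d 4 5)
    (h7 : 7 ≤ (((Finset.univ : Finset (Fin 6)).offDiag).image fun p => d p.1 p.2).card) :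
    False := by
  obtain ⟨k1, a1, b1, c1⟩ := exists_slot (hPM 0 2 1 3 4 5 (by decide))
  obtain ⟨k2, a2, b2, c2⟩ := exists_slot (hPM 0 3 1 2 4 5 (by decide))
  obtain ⟨k3, a3, b3, c3⟩ := exists_slot (hPM 2 4 3 5 0 1 (by decide))
  obtain ⟨k4, a4, b4, c4⟩ := exists_slot (hPM 2 5 3 4 0 1 (by decide))
  obtain ⟨k5, a5, b5, c5⟩ := exists_slot (hPM 0 4 1 5 2 3 (by decide))
  obtain ⟨k6, a6, b6, c6⟩ := exists_slot (hPM 0 5 1 4 2 3 (by decide))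
  rw [h1] at a3 b3 a4 b4
  -- These are the eight perfect matchings that use none of 01, 23, 45.
  have m1 := hPM 0 2 3 4 1 5 (by decide)
  have m2 := hPM 0 2 3 5 1 4 (by decide)
  have m3 := hPM 0 3 2 4 1 5 (by decide)
  have m4 := hPM 0 3 2 5 1 4 (by decide)
  have m5 := hPM 1 2 3 4 0 5 (by decide)
  have m6 := hPM 1 2 3 5 0 4 (by decide)
  have m7 := hPM 1 3 2 4 0 5 (by decide)
  have m8 := hPM 1 3 2 5 0 4 (by decide)
  have hI : ∀ x, x ∈ Finset.univ.image ![d 2 3, d 4 5, k1, k2, k3, k4, k5, k6] ↔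
      x = d 2 3 ∨ x = d 4 5 ∨ x = k1 ∨ x = k2 ∨ x = k3 ∨ x = k4 ∨ x = k5 ∨ x = k6 := by
    intro x
    simp [Fin.exists_fin_succ, eq_comm]
  have hsub : ((Finset.univ : Finset (Fin 6)).offDiag).image (fun p => d p.1 p.2) ⊆
      Finset.univ.image ![d 2 3, d 4 5, k1, k2, k3, k4, k5, k6] := by
    clear m1 m2 m3 m4 m5 m6 m7 m8 c1 c2 c3 c4 c5 c6 hPM h7 h2
    generalize Finset.univ.image ![d 2 3, d 4 5, k1, k2, k3, k4, k5, k6] = I at hI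
    have aux : ∀ x k t, (x = k ∨ x = t) → k ∈ I → t ∈ I → x ∈ I := by
      rintro x k t (rfl | rfl) h h'
      · exact h
      · exact h'
    have po : d 2 3 ∈ I := by rw [hI]; simp
    have pt : d 4 5 ∈ I := by rw [hI]; simp
    have p01 : d 0 1 ∈ I := by rw [h1]; exact po
    have pk1 : k1 ∈ I := by rw [hI]; simp
    have pk2 : k2 ∈ I := by rw [hI]; simp
    have pk3 : k3 ∈ I := by rw [hI]; simp
    have pk4 : k4 ∈ I := by rw [hI]; simp
    have pk5 : k5 ∈ I := by rw [hI]; simp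
    have pk6 : k6 ∈ I := by rw [hI]; simp
    have q1 := aux _ _ _ a1 pk1 pt
    have q2 := aux _ _ _ b1 pk1 pt
    have q3 := aux _ _ _ a2 pk2 pt
    have q4 := aux _ _ _ b2 pk2 pt
    have q5 := aux _ _ _ a3 pk3 po
    have q6 := aux _ _ _ b3 pk3 po
    have q7 := aux _ _ _ a4 pk4 po
    have q8 := aux _ _ _ b4 pk4 po
    have q9 := aux _ _ _ a5 pk5 po
    have q10 := aux _ _ _ b5 pk5 po
    have q11 := aux _ _ _ a6 pk6 po
    have q12 := aux _ _ _ b6 pk6 po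
    clear a1 b1 a2 b2 a3 b3 a4 b4 a5 b5 a6 b6 hI
    intro κ hκ
    obtain ⟨⟨i, j⟩, hij, rfl⟩ := Finset.mem_image.1 hκ
    simp only [Finset.mem_offDiag, Finset.mem_univ, true_and] at hij
    have key : ∀ i j : Fin 6, i < j → d i j ∈ I := by
      intro i j hij
      fin_cases i <;> fin_cases j <;> first | (exfalso; revert hij; decide) | assumption
    rcases lt_or_gt_of_ne hij with h | h
    · exact key i j h
    · rw [hs]; exact key j i h
  obtain ⟨j, hj, hne⟩ := exists_ne_of_seven_le_card (by simpa using h2)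
    (h7.trans (Finset.card_le_card hsub))
  have n01 := hne 0 1 (by decide)
  clear hsub h7 hPM hI
  generalize d 0 1 = x1, d 2 3 = o, d 4 5 = t at *
  fin_cases j
  · simp at hj
  · simp at hj
  all_goals simp [Fin.forall_fin_succ] at hne
  all_goals clear n01 hj hs
  all_goals grind

/-- A coloring of `K₆` with seven colors has a rainbow perfect matching. -/
theorem hasRM_three {c : Sym2 V → K} {W : Finset V} (hW : W.card = 6)
    (hm : 7 ≤ (colors c W).card) : HasRM c W 3 := by
  by_contra hno
  obtain ⟨M, hMW, hM, hi, hMc⟩ := hasRM_two (c := c) (W := W) (by omega) (by omega)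
  have hZ : (W \ cov M).card = 2 := by
    rw [Finset.card_sdiff_of_subset (cov_subset hMW), hM.card_cov]; omega
  obtain ⟨u, v, huv, hZuv⟩ := Finset.card_eq_two.1 hZ
  have hu : u ∈ W \ cov M := by rw [hZuv]; simp
  have hv : v ∈ W \ cov M := by rw [hZuv]; simp
  rw [Finset.mem_sdiff] at hu hv
  obtain ⟨a, b, hab, hcab⟩ := exists_color_eq hMW hM hi (by rw [hMc]; exact hno) hu.1 hv.1
    hu.2 hv.2 huv
  obtain ⟨e, he⟩ : ∃ e, M.erase s(a, b) = {e} := by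
    rw [← Finset.card_eq_one, Finset.card_erase_of_mem hab, hMc]
  obtain ⟨p, q, rfl⟩ : ∃ p q, e = s(p, q) := ⟨_, _, (Quot.out_eq e).symm⟩
  have hpq : s(p, q) ∈ M.erase s(a, b) := by rw [he]; simp
  have hpq' := (Finset.mem_erase.1 hpq).2
  have ha : a ∈ cov M := mem_cov.2 ⟨_, hab, by simp⟩
  have hb : b ∈ cov M := mem_cov.2 ⟨_, hab, by simp⟩
  have hp : p ∈ cov (M.erase s(a, b)) := mem_cov.2 ⟨_, hpq, by simp⟩
  have hq : q ∈ cov (M.erase s(a, b)) := mem_cov.2 ⟨_, hpq, by simp⟩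
  rw [hM.mem_cov_erase hab] at hp hq
  have hne1 : a ≠ b := by simpa using hM.nd _ hab
  have hne2 : p ≠ q := by simpa using hM.nd _ hpq'
  have hcW := cov_subset hMW
  -- The order makes 01 and 23 the equally colored edges uv and ab, and 45 the other edge of M.
  let f : Fin 6 → V := [u, v, a, b, p, q].get
  have hfW : ∀ i, f i ∈ W := by
    intro i
    fin_cases i
    exacts [hu.1, hv.1, hcW ha, hcW hb, hcW hp.1, hcW hq.1]
  have hne : ∀ x ∈ cov M, u ≠ x ∧ v ≠ x := fun x hx =>
    ⟨fun h => hu.2 (h ▸ hx), fun h => hv.2 (h ▸ hx)⟩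
  have hf : Function.Injective f := by
    have h1 := hne a ha
    have h2 := hne b hb
    have h3 := hne p hp.1
    have h4 := hne q hq.1
    have hnd : [u, v, a, b, p, q].Nodup := by
      simp only [List.nodup_cons, List.mem_cons, List.not_mem_nil, or_false, not_or,
        not_false_eq_true, List.nodup_nil, and_true]
      exact ⟨⟨huv, h1.1, h2.1, h3.1, h4.1⟩, ⟨h1.2, h2.2, h3.2, h4.2⟩,
        ⟨hne1, hp.2.1.symm, hq.2.1.symm⟩, ⟨hp.2.2.symm, hq.2.2.symm⟩, hne2⟩
    rw [List.nodup_iff_injective_get] at hnd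
    exact hnd
  have hfim : Finset.univ.image f = W := by
    apply Finset.eq_of_subset_of_card_le
    · intro x hx
      obtain ⟨i, -, rfl⟩ := Finset.mem_image.1 hx
      exact hfW i
    · rw [Finset.card_image_of_injective _ hf, hW]; simp
  refine not_seven_colors (fun i j => c s(f i, f j)) (fun i j => by rw [Sym2.eq_swap]) ?_
    hcab ?_ ?_
  · intro i1 i2 i3 i4 i5 i6 hnd
    by_contra hcon
    push Not at hcon
    simp only [List.nodup_cons, List.mem_cons, List.not_mem_nil, or_false, not_or,
      not_false_eq_true, List.nodup_nil, and_true] at hnd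
    have h0 : IsMatch (∅ : Finset (Sym2 V)) := ⟨by simp, by simp⟩
    have hc0 : cov (∅ : Finset (Sym2 V)) = ∅ := by simp [cov]
    have g1 := h0.insert_edge (x := f i5) (y := f i6) (by simp [hc0]) (by simp [hc0])
      (hf.ne hnd.2.2.2.2)
    have g2 := g1.insert_edge (x := f i3) (y := f i4)
      (by simp [hf.eq_iff]; tauto)
      (by simp [hf.eq_iff]; tauto) (hf.ne (by tauto))
    have hk : insert s(f i3, f i4) (insert s(f i5, f i6) (∅ : Finset (Sym2 V))) ⊆ pairs W := by
      intro e he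
      simp only [Finset.mem_insert, Finset.notMem_empty, or_false] at he
      rcases he with rfl | rfl
      · exact mk_mem_pairs.2 ⟨hfW _, hfW _, hf.ne (by tauto)⟩
      · exact mk_mem_pairs.2 ⟨hfW _, hfW _, hf.ne hnd.2.2.2.2⟩
    have hr1 : Set.InjOn c (insert s(f i5, f i6) (∅ : Finset (Sym2 V)) : Finset (Sym2 V)) := by
      simp
    have hr2 := rainbow_insert hr1 (e := s(f i3, f i4)) (by simpa using hcon.2.2)
    refine hno ((HasRM.insert_edge hk g2 hr2 subset_rfl (hfW i1) (hfW i2) ?_ ?_ (hf.ne (by tauto))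
      ?_).le ?_)
    · simp [hf.eq_iff]; tauto
    · simp [hf.eq_iff]; tauto
    · simpa using ⟨hcon.1, hcon.2.1⟩
    · rw [card_insert_edge (by simp [hf.eq_iff]; tauto)]
      simp
  · intro h
    exact (Finset.mem_erase.1 hpq).1 (hi hpq' hab h.symm)
  · refine hm.trans (Finset.card_le_card ?_)
    intro κ hκ
    obtain ⟨e, he, rfl⟩ := Finset.mem_image.1 hκ
    revert he
    induction e with
    | _ x y =>
      intro he
      obtain ⟨hx, hy, hxy⟩ := mk_mem_pairs.1 he
      rw [← hfim] at hx hy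
      obtain ⟨i, -, rfl⟩ := Finset.mem_image.1 hx
      obtain ⟨j, -, rfl⟩ := Finset.mem_image.1 hy
      exact Finset.mem_image.2 ⟨(i, j), by simpa using fun h => hxy (congrArg f h), rfl⟩

end Six

/-! ### Order 2σ + 4 with large minimum degree. -/

section Even

variable {V K : Type*} [DecidableEq V] [DecidableEq K]

theorem IsRep.exchange {c : Sym2 V → K} {W : Finset V} {G : Finset (Sym2 V)} (hG : IsRep c W G)
    {a b u v : V} (hab : s(a, b) ∈ G) (huv : s(u, v) ∈ pairs W) (hc : c s(u, v) = c s(a, b)) :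
    IsRep c W (insert s(u, v) (G.erase s(a, b))) := by
  refine ⟨Finset.insert_subset huv ((Finset.erase_subset _ _).trans hG.sub), ?_, ?_⟩
  · refine rainbow_insert (hG.inj.mono (Finset.coe_subset.2 (Finset.erase_subset _ _))) ?_
    rw [hc]
    intro h
    obtain ⟨e, he, hce⟩ := Finset.mem_image.1 h
    obtain ⟨hne, heM⟩ := Finset.mem_erase.1 he
    exact hne (hG.inj heM hab hce)
  · rw [Finset.image_insert, hc, ← Finset.image_insert, Finset.insert_erase hab, hG.img]

theorem nbr_exchange {G : Finset (Sym2 V)} {a b u v : V} (hau : a ≠ u) (hav : a ≠ v) :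
    nbr (insert s(u, v) (G.erase s(a, b))) a = (nbr G a).erase b := by
  ext x
  simp only [mem_nbr, Finset.mem_insert, Finset.mem_erase, ne_eq, Sym2.congr_right]
  constructor
  · rintro (h | h)
    · rcases Sym2.eq_iff.1 h with ⟨h, -⟩ | ⟨h, -⟩
      · exact absurd h hau
      · exact absurd h hav
    · exact h
  · exact Or.inr

/-- The counting step for a maximum matching that misses exactly two vertices `p, p'`, where `qq'`
is a matching edge of the same color as `pp'`. -/
theorem mem_nbr_of_mem_nbr {M G : Finset (Sym2 V)} (hM : IsMatch M) (hMG : M ⊆ G)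
    (hnd : ∀ e ∈ G, ¬ e.IsDiag) (hNB : NoBigger M G) {p p' q q' : V} (hp : p ∉ cov M)
    (hp' : p' ∉ cov M) (hpp : p ≠ p') (hqq : s(q, q') ∈ M)
    (hdp : (nbr G p).card = M.card) (hdp' : (nbr G p').card = M.card)
    (hdq : (nbr G q).card = M.card + 1) (hdq' : (nbr G q').card = M.card + 1)
    (hq : (nbr G q).erase q' ⊆ insert p (insert p' (cov M)))
    (h : q' ∈ nbr G p) : q ∈ nbr G p' := by
  by_contra hcon
  have hqc : q ∈ cov M := mem_cov.2 ⟨_, hqq, by simp⟩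
  have hqc' : q' ∈ cov M := mem_cov.2 ⟨_, hqq, by simp⟩
  have hqn : q ≠ q' := by simpa using hM.nd _ hqq
  obtain ⟨μ, m1, m2, m3, m4, m5⟩ := hM.exists_mate
  have hEq := (nbr_add_nbr hM hMG hnd hNB hp hp' hpp).2 (by omega)
  -- If x were not adjacent to p, tightness would make its mate adjacent to p'. Shifting M along p',
  -- mate of x, x, q, q' uncovers p and q', whose degree sum is 2|M| + 1.
  have hsub : ∀ x ∈ (nbr G q).erase q', x ≠ p → x ∈ ((nbr G p).erase q').erase q := by
    intro x hx hxp
    obtain ⟨hxq', hxq⟩ := Finset.mem_erase.1 hx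
    have hxqn : x ≠ q := by
      rintro rfl
      exact hnd _ (mem_nbr.1 hxq) (by simp)
    have hxp' : x ≠ p' := by
      rintro rfl
      exact hcon (mem_nbr_comm.1 hxq)
    have hxc : x ∈ cov M := by
      have := hq hx
      simp only [Finset.mem_insert] at this
      tauto
    rw [Finset.mem_erase, Finset.mem_erase]
    refine ⟨hxqn, hxq', ?_⟩
    refine hEq (μ x) x (by rw [Sym2.eq_swap]; exact m1 x hxc) ?_
    intro hμ
    -- exchange along the path from `p'` through the edge of `x` to `q`
    have hmx : s(μ x, x) ∈ M := by rw [Sym2.eq_swap]; exact m1 x hxc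
    obtain ⟨s1, s2, s3⟩ := hM.swap hmx hp'
    have hqM1 : s(q, q') ∈ insert s(p', μ x) (M.erase s(μ x, x)) := by
      refine Finset.mem_insert_of_mem (Finset.mem_erase.2 ⟨?_, hqq⟩)
      intro he
      have : x ∈ s(q, q') := he ▸ Sym2.mem_mk_right _ x
      rcases Sym2.mem_iff.1 this with h | h
      · exact hxqn h
      · exact hxq' h
    obtain ⟨t1, t2, t3⟩ := s1.swap hqM1 (u := x) (by
      rw [s3]; rintro (h | h)
      · exact hxp' h
      · exact h.2 rfl)
    have hsub2 : insert s(x, q) ((insert s(p', μ x) (M.erase s(μ x, x))).erase s(q, q')) ⊆ G := by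
      refine Finset.insert_subset (by rw [Sym2.eq_swap]; exact mem_nbr.1 hxq)
        ((Finset.erase_subset _ _).trans (Finset.insert_subset (mem_nbr.1 hμ)
          ((Finset.erase_subset _ _).trans hMG)))
    have hd := (nbr_add_nbr t1 hsub2 hnd (hNB.of_card_eq (t2.trans s2)) (u := p) (v := q')
      (by rw [t3, s3]; rintro (h | ⟨h | h, -⟩)
          · exact hxp h.symm
          · exact hpp h
          · exact hp h.1)
      (by rw [t3, s3]; rintro (h | ⟨-, h⟩)
          · exact hxq' h.symm
          · exact h rfl) (by rintro rfl; exact hp hqc')).1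
    rw [t2, s2] at hd
    omega
  have hq'q : q' ∈ nbr G q := mem_nbr.2 (hMG hqq)
  have hc1 : ((nbr G q).erase q').card = M.card := by
    rw [Finset.card_erase_of_mem hq'q, hdq]; rfl
  have hc2 := Finset.card_erase_of_mem h
  -- In both cases the inclusion leaves room for at most |M| − 1 of the |M| neighbours of q other
  -- than q'.
  by_cases hqp : q ∈ nbr G p
  · have hs : (nbr G q).erase q' ⊆ insert p (((nbr G p).erase q').erase q) := by
      intro x hx
      by_cases hxp : x = p
      · exact Finset.mem_insert.2 (Or.inl hxp)
      · exact Finset.mem_insert_of_mem (hsub x hx hxp)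
    have h1 := (Finset.card_le_card hs).trans (Finset.card_insert_le _ _)
    have h2 := Finset.card_erase_of_mem (Finset.mem_erase.2 ⟨hqn, hqp⟩)
    have h3 := Finset.card_pos.2 ⟨_, Finset.mem_erase.2 ⟨hqn, hqp⟩⟩
    omega
  · have hs : (nbr G q).erase q' ⊆ (nbr G p).erase q' := by
      intro x hx
      refine (Finset.mem_erase.1 (hsub x hx ?_)).2
      rintro rfl
      exact hqp (mem_nbr_comm.1 (Finset.mem_erase.1 hx).2)
    have h1 := Finset.card_le_card hs
    have h3 := Finset.card_pos.2 ⟨_, h⟩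
    omega

/-- If every representing graph on `2σ + 4` vertices has minimum degree at least `σ + 1`, then a
rainbow matching with `σ + 1` edges can be enlarged. -/
theorem hasRM_of_min_degree {c : Sym2 V → K} {W : Finset V} {σ : ℕ} (hW : W.card = 2 * σ + 4)
    (hRM : HasRM c W (σ + 1))
    (hdeg : ∀ G, IsRep c W G → ∀ z ∈ W, σ + 1 ≤ (nbr G z).card) : HasRM c W (σ + 2) := by
  by_contra hno
  obtain ⟨M, hMW, hM, hi, hMc⟩ := hRM
  have hno' : ¬ HasRM c W (M.card + 1) := by rw [hMc]; exact hno
  obtain ⟨G, hMG, hG⟩ := exists_isRep c W hMW hi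
  have hNB := hG.noBigger hno'
  have hnd : ∀ e ∈ G, ¬ e.IsDiag := fun e he => not_isDiag_of_mem_pairs (hG.sub he)
  have hZ : (W \ cov M).card = 2 := by
    rw [Finset.card_sdiff_of_subset (cov_subset hMW), hM.card_cov]; omega
  obtain ⟨u, v, huv, hZuv⟩ := Finset.card_eq_two.1 hZ
  have hu : u ∈ W \ cov M := by rw [hZuv]; simp
  have hv : v ∈ W \ cov M := by rw [hZuv]; simp
  rw [Finset.mem_sdiff] at hu hv
  obtain ⟨a, b, hab, hcab⟩ := exists_color_eq hMW hM hi hno' hu.1 hv.1 hu.2 hv.2 huv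
  have ha : a ∈ cov M := mem_cov.2 ⟨_, hab, by simp⟩
  have hb : b ∈ cov M := mem_cov.2 ⟨_, hab, by simp⟩
  have hne : a ≠ b := by simpa using hM.nd _ hab
  obtain ⟨M', hM', i1, i2, i3, i4, i5, i6⟩ :=
    exchange hMW hM hi hab hcab hu.1 hv.1 hu.2 hv.2 huv
  have hG' := hG.exchange (hMG hab) (mk_mem_pairs.2 ⟨hu.1, hv.1, huv⟩) hcab
  have hM'G' : M' ⊆ insert s(u, v) (G.erase s(a, b)) := by
    rw [hM']; exact Finset.insert_subset_insert _ (Finset.erase_subset_erase _ hMG)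
  have hNB' := hG'.noBigger (M := M') (by rw [i4]; exact hno')
  have hnd' : ∀ e ∈ insert s(u, v) (G.erase s(a, b)), ¬ e.IsDiag :=
    fun e he => not_isDiag_of_mem_pairs (hG'.sub he)
  have hau : a ≠ u := fun h => hu.2 (h ▸ ha)
  have hav : a ≠ v := fun h => hv.2 (h ▸ ha)
  have hbu : b ≠ u := fun h => hu.2 (h ▸ hb)
  have hbv : b ≠ v := fun h => hv.2 (h ▸ hb)
  have haM' : a ∉ cov M' := by rw [i6]; tauto
  have hbM' : b ∉ cov M' := by rw [i6]; tauto
  have na := nbr_exchange (G := G) (b := b) hau hav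
  have nb : nbr (insert s(u, v) (G.erase s(a, b))) b = (nbr G b).erase a := by
    rw [Sym2.eq_swap (a := a)]; exact nbr_exchange hbu hbv
  have hsum := (nbr_add_nbr hM hMG hnd hNB hu.2 hv.2 huv).1
  have hsum' := (nbr_add_nbr i2 hM'G' hnd' hNB' haM' hbM' hne).1
  have dU := hdeg G hG u hu.1
  have dV := hdeg G hG v hv.1
  -- The degree hypothesis is also applied to the exchanged graph. There a and b have lost the edge
  -- ab, so tightness gives them degree σ + 2 in G, while u and v have degree σ + 1.
  have dA := hdeg _ hG' a (cov_subset hMW ha)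
  have dB := hdeg _ hG' b (cov_subset hMW hb)
  have sA := nbr_subset_cov i2 hM'G' hnd' hNB' haM'
  have sB := nbr_subset_cov i2 hM'G' hnd' hNB' hbM'
  have hba : b ∈ nbr G a := mem_nbr.2 (hMG hab)
  have hab' : a ∈ nbr G b := mem_nbr_comm.1 hba
  have cA := Finset.card_erase_of_mem hba
  have cB := Finset.card_erase_of_mem hab'
  have pA := Finset.card_pos.2 ⟨_, hba⟩
  have pB := Finset.card_pos.2 ⟨_, hab'⟩
  rw [na] at dA hsum' sA
  rw [nb] at dB hsum' sB
  have hcov' : cov M' ⊆ insert u (insert v (cov M)) := by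
    intro x hx; rw [i6] at hx; simp only [Finset.mem_insert]; tauto
  have hcov'' : cov M' ⊆ insert v (insert u (cov M)) := by
    rw [Finset.insert_comm]; exact hcov'
  have hba' : s(b, a) ∈ M := by rw [Sym2.eq_swap]; exact hab
  -- The implications are inconsistent: `r3` and `t1` exclude ua, then `t2` forces vb, and `r2`
  -- forces ua.
  have r1 : b ∈ nbr G u → a ∈ nbr G v :=
    mem_nbr_of_mem_nbr hM hMG hnd hNB hu.2 hv.2 huv hab (by omega) (by omega) (by omega)
      (by omega) (sA.trans hcov')
  have r2 : b ∈ nbr G v → a ∈ nbr G u :=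
    mem_nbr_of_mem_nbr hM hMG hnd hNB hv.2 hu.2 huv.symm hab (by omega) (by omega) (by omega)
      (by omega) (sA.trans hcov'')
  have r3 : a ∈ nbr G u → b ∈ nbr G v :=
    mem_nbr_of_mem_nbr hM hMG hnd hNB hu.2 hv.2 huv hba' (by omega) (by omega) (by omega)
      (by omega) (sB.trans hcov')
  have t1 : a ∈ nbr G u → b ∉ nbr G v := mate_notMem_nbr hM hMG hNB hu.2 hv.2 huv hab
  have t2 := (nbr_add_nbr hM hMG hnd hNB hu.2 hv.2 huv).2 (by omega) b a hba'
  tauto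

end Even

/-! ### Extremal colorings of even order. -/

section EvenStructure

variable {V K : Type*} [DecidableEq V] [DecidableEq K]

/-- Every even subset of `A` with at least eight vertices has rainbow perfect matchings that avoid
any three given colors. -/
def Robust (c : Sym2 V → K) (A : Finset V) : Prop :=
  ∀ U ⊆ A, ∀ j, U.card = 2 * j → 4 ≤ j → ∀ C : Finset K, C.card ≤ 3 →
    ∃ M ⊆ pairs U, IsMatch M ∧ Set.InjOn c M ∧ M.card = j ∧ ∀ e ∈ M, c e ∉ C

/-- Inside U at most two edges are missing from G and at most three have forbidden colors. Since j ≥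
4, five missing edges neither isolate a vertex nor exceed the 4j − 7 allowed by `exists_perfect`. -/
theorem robust_of_card {c : Sym2 V → K} {G : Finset (Sym2 V)} {A : Finset V}
    (hi : Set.InjOn c G) (hA : (pairs A).card ≤ (G.filter (· ∈ pairs A)).card + 2) :
    Robust c A := by
  intro U hU j hUj hj C hC
  set H := G.filter fun e => e ∈ pairs U ∧ c e ∉ C with hH
  have hHU : H ⊆ pairs U := fun e he => (Finset.mem_filter.1 he).2.1
  have hmiss : (pairs A \ G).card ≤ 2 := by
    have h1 := Finset.card_sdiff_add_card_inter (pairs A) G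
    have h2 : pairs A ∩ G = G.filter (· ∈ pairs A) := by
      ext e; simp [and_comm]
    rw [h2] at h1
    omega
  have hcol : (G.filter fun e => c e ∈ C).card ≤ 3 := by
    refine le_trans ?_ hC
    rw [← Finset.card_image_of_injOn (hi.mono (Finset.coe_subset.2 (Finset.filter_subset _ _)))]
    refine Finset.card_le_card ?_
    intro κ hκ
    obtain ⟨e, he, rfl⟩ := Finset.mem_image.1 hκ
    exact (Finset.mem_filter.1 he).2
  have hcover : pairs U ⊆ H ∪ (pairs A \ G) ∪ (G.filter fun e => c e ∈ C) := by
    intro e he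
    have heA := pairs_mono hU he
    simp only [hH, Finset.mem_union, Finset.mem_filter, Finset.mem_sdiff]
    tauto
  have hcard := Finset.card_le_card hcover
  have h1 := Finset.card_union_le (H ∪ (pairs A \ G)) (G.filter fun e => c e ∈ C)
  have h2 := Finset.card_union_le H (pairs A \ G)
  rw [card_pairs, hUj] at hcard
  have hiso : ∀ x ∈ U, (nbr H x).Nonempty := by
    intro x hx
    by_contra hemp
    rw [Finset.not_nonempty_iff_eq_empty] at hemp
    have h3 := card_le_sum_nbr_add (S := {x}) hHU
    rw [Finset.sum_singleton, hemp, Finset.card_sdiff_of_subset (by simpa using hx), hUj] at h3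
    simp only [Finset.card_empty, Finset.card_singleton, zero_add] at h3
    have e1 := two_mul_choose_two (2 * j)
    have e2 := two_mul_choose_two (2 * j - 1)
    obtain ⟨i, rfl⟩ : ∃ i, j = i + 1 := ⟨j - 1, by omega⟩
    rw [show 2 * (i + 1) - 1 = 2 * i + 1 by omega] at *
    nlinarith
  obtain ⟨M, hMH, hM, hMc⟩ := exists_perfect hHU hUj hiso (by omega)
  refine ⟨M, hMH.trans hHU, hM, ?_, hMc, fun e he => (Finset.mem_filter.1 (hMH he)).2.2⟩
  exact hi.mono (Finset.coe_subset.2 (hMH.trans (Finset.filter_subset _ _)))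

/-- The structure of extremal colorings of a complete graph of even order. -/
def EvenExtremal (c : Sym2 V → K) (W : Finset V) : Prop :=
  ∃ x₁ ∈ W, ∃ x₂ ∈ W, ∃ x₃ ∈ W, x₁ ≠ x₂ ∧ x₁ ≠ x₃ ∧ x₂ ≠ x₃ ∧
    c s(x₂, x₃) ≠ c s(x₁, x₃) ∧ Robust c (W \ {x₁, x₂, x₃})

/-- Extend a rainbow matching that avoids two colors by two edges of these colors. -/
theorem hasRM_add_two {c : Sym2 V → K} {W U : Finset V} {M : Finset (Sym2 V)} {x y z w : V}
    (hM : M ⊆ pairs U) (hm : IsMatch M) (hi : Set.InjOn c M) (hUW : U ⊆ W)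
    (hnd : [x, y, z, w].Nodup) (hW : ∀ t ∈ [x, y, z, w], t ∈ W) (hU : ∀ t ∈ [x, y, z, w], t ∉ U)
    (hxy : ∀ e ∈ M, c e ≠ c s(x, y)) (hzw : ∀ e ∈ M, c e ≠ c s(z, w))
    (hne : c s(x, y) ≠ c s(z, w)) : HasRM c W (M.card + 2) := by
  have hcov := cov_subset hM
  simp only [List.nodup_cons, List.mem_cons, List.not_mem_nil, or_false, not_or,
    not_false_eq_true, List.nodup_nil, and_true] at hnd
  simp only [List.mem_cons, List.not_mem_nil, or_false, forall_eq_or_imp, forall_eq] at hW hU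
  have hx : x ∉ cov M := fun h => hU.1 (hcov h)
  have hy : y ∉ cov M := fun h => hU.2.1 (hcov h)
  have hz : z ∉ cov M := fun h => hU.2.2.1 (hcov h)
  have hw : w ∉ cov M := fun h => hU.2.2.2 (hcov h)
  have h1 := hm.insert_edge hx hy hnd.1.1
  have h2 : insert s(x, y) M ⊆ pairs W := Finset.insert_subset
    (mk_mem_pairs.2 ⟨hW.1, hW.2.1, hnd.1.1⟩) (hM.trans (pairs_mono hUW))
  have h3 := rainbow_insert hi (e := s(x, y)) (by
    intro h; obtain ⟨e, he, hce⟩ := Finset.mem_image.1 h; exact hxy e he hce)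
  have h4 := HasRM.insert_edge h2 h1 h3 subset_rfl hW.2.2.1 hW.2.2.2 (x := z) (y := w)
    (by rw [cov_insert]; simp only [Finset.mem_insert, not_or]
        exact ⟨Ne.symm hnd.1.2.1, Ne.symm hnd.2.1.1, hz⟩)
    (by rw [cov_insert]; simp only [Finset.mem_insert, not_or]
        exact ⟨Ne.symm hnd.1.2.2, Ne.symm hnd.2.1.2, hw⟩)
    hnd.2.2
    (by rw [Finset.image_insert, Finset.mem_insert]
        rintro (h | h)
        · exact hne h.symm
        · obtain ⟨e, he, hce⟩ := Finset.mem_image.1 h; exact hzw e he hce)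
  rwa [card_insert_edge hx] at h4

/-- The edges from a vertex outside a robust set to this set have the color of the edge between
two other outside vertices. -/
theorem color_eq_of_robust {c : Sym2 V → K} {W A : Finset V} {j : ℕ} (hA : Robust c A)
    (hAW : A ⊆ W) (hj : 4 ≤ j) (hAc : A.card = 2 * j + 1) (hno : ¬ HasRM c W (j + 2))
    {x y z t : V} (hnd : [x, y, z].Nodup) (hW : ∀ w ∈ [x, y, z], w ∈ W)
    (hnA : ∀ w ∈ [x, y, z], w ∉ A) (ht : t ∈ A) : c s(z, t) = c s(x, y) := by
  by_contra hne
  -- A rainbow perfect matching of A − t that avoids both colors is completed by xy and zt.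
  obtain ⟨M, h1, h2, h3, h4, h5⟩ := hA (A.erase t) (Finset.erase_subset _ _) j
    (by rw [Finset.card_erase_of_mem ht, hAc]; omega) hj {c s(x, y), c s(z, t)}
    (Finset.card_le_two.trans (by omega))
  simp only [List.nodup_cons, List.mem_cons, List.not_mem_nil, or_false, not_or,
    not_false_eq_true, List.nodup_nil, and_true] at hnd
  simp only [List.mem_cons, List.not_mem_nil, or_false, forall_eq_or_imp, forall_eq] at hW hnA
  refine hno (h4 ▸ hasRM_add_two h1 h2 h3 ((Finset.erase_subset _ _).trans hAW)
    (x := x) (y := y) (z := z) (w := t) ?_ ?_ ?_ ?_ ?_ (Ne.symm hne))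
  · have hxt : x ≠ t := fun h => hnA.1 (h ▸ ht)
    have hyt : y ≠ t := fun h => hnA.2.1 (h ▸ ht)
    have hzt : z ≠ t := fun h => hnA.2.2 (h ▸ ht)
    simp only [List.nodup_cons, List.mem_cons, List.not_mem_nil, or_false, not_or,
      not_false_eq_true, List.nodup_nil, and_true]
    tauto
  · simp only [List.mem_cons, List.not_mem_nil, or_false, forall_eq_or_imp, forall_eq]
    exact ⟨hW.1, hW.2.1, hW.2.2, hAW ht⟩
  · simp only [List.mem_cons, List.not_mem_nil, or_false, forall_eq_or_imp, forall_eq,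
      Finset.mem_erase]
    tauto
  · intro e he h; exact h5 e he (by simp [h])
  · intro e he h; exact h5 e he (by simp [h])

/-- Without the matching, an edge from u to the robust set would have both the color of x₂x₃ and
that of x₁x₃, which differ. -/
theorem hasRM_of_evenExtremal {c : Sym2 V → K} {W : Finset V} {j : ℕ} (hj : 4 ≤ j)
    (hW : W.card = 2 * j + 5) {u : V} (hu : u ∈ W) (h : EvenExtremal c (W.erase u)) :
    HasRM c W (j + 2) := by
  by_contra hno
  obtain ⟨x₁, h1, x₂, h2, x₃, h3, h12, h13, h23, hne, hR⟩ := h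
  have hsub : ({x₁, x₂, x₃} : Finset V) ⊆ W.erase u := by
    intro z hz
    simp only [Finset.mem_insert, Finset.mem_singleton] at hz
    rcases hz with rfl | rfl | rfl <;> assumption
  have hcard : (W.erase u \ {x₁, x₂, x₃}).card = 2 * j + 1 := by
    rw [Finset.card_sdiff_of_subset hsub, Finset.card_erase_of_mem hu, hW,
      Finset.card_eq_three.2 ⟨x₁, x₂, x₃, h12, h13, h23, rfl⟩]
    omega
  obtain ⟨t, ht⟩ := Finset.card_pos.1 (by omega : 0 < (W.erase u \ {x₁, x₂, x₃}).card)
  have hAW : W.erase u \ {x₁, x₂, x₃} ⊆ W := Finset.sdiff_subset.trans (Finset.erase_subset _ _)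
  obtain ⟨n1, w1⟩ := Finset.mem_erase.1 h1
  obtain ⟨n2, w2⟩ := Finset.mem_erase.1 h2
  obtain ⟨n3, w3⟩ := Finset.mem_erase.1 h3
  have e1 := color_eq_of_robust hR hAW hj hcard hno (x := x₂) (y := x₃) (z := u)
    (by simp [h23, n2, n3]) (by simp [w2, w3, hu]) (by simp) ht
  have e2 := color_eq_of_robust hR hAW hj hcard hno (x := x₁) (y := x₃) (z := u)
    (by simp [h13, n1, n3]) (by simp [w1, w3, hu]) (by simp) ht
  exact hne (e1.symm.trans e2)

/-- The structure around three exceptional vertices when there is no rainbow perfect matching. -/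
theorem evenExtremal_of_robust {c : Sym2 V → K} {W : Finset V} {τ : ℕ} (hτ : 4 ≤ τ)
    (hW : W.card = 2 * τ + 6) (hno : ¬ HasRM c W (τ + 3))
    (hm : (τ + 1) * (2 * τ + 3) + 2 ≤ (colors c W).card)
    {x₁ x₂ x₃ : V} (h1 : x₁ ∈ W) (h2 : x₂ ∈ W) (h3 : x₃ ∈ W) (h12 : x₁ ≠ x₂) (h13 : x₁ ≠ x₃)
    (h23 : x₂ ≠ x₃) (hR : Robust c (W \ {x₁, x₂, x₃})) :
    EvenExtremal c W ∧ (colors c W).card ≤ (τ + 1) * (2 * τ + 3) + 2 := by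
  have hsub : ({x₁, x₂, x₃} : Finset V) ⊆ W := by
    intro z hz
    simp only [Finset.mem_insert, Finset.mem_singleton] at hz
    rcases hz with rfl | rfl | rfl <;> assumption
  set A := W \ {x₁, x₂, x₃} with hA
  have hcard : A.card = 2 * (τ + 1) + 1 := by
    rw [Finset.card_sdiff_of_subset hsub, hW,
      Finset.card_eq_three.2 ⟨x₁, x₂, x₃, h12, h13, h23, rfl⟩]
    omega
  have hAW : A ⊆ W := Finset.sdiff_subset
  have n1 : x₁ ∉ A := by simp [hA]
  have n2 : x₂ ∉ A := by simp [hA]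
  have n3 : x₃ ∉ A := by simp [hA]
  have e1 : ∀ t ∈ A, c s(x₁, t) = c s(x₂, x₃) := fun t ht =>
    color_eq_of_robust hR hAW (by omega) hcard hno (by simp [h23, h12.symm, h13.symm])
      (by simp [h1, h2, h3]) (by simp [n1, n2, n3]) ht
  have e2 : ∀ t ∈ A, c s(x₂, t) = c s(x₁, x₃) := fun t ht =>
    color_eq_of_robust hR hAW (by omega) hcard hno (by simp [h23.symm, h12, h13])
      (by simp [h1, h2, h3]) (by simp [n1, n2, n3]) ht
  have e3 : ∀ t ∈ A, c s(x₃, t) = c s(x₁, x₂) := fun t ht =>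
    color_eq_of_robust hR hAW (by omega) hcard hno (by simp [h23, h12, h13])
      (by simp [h1, h2, h3]) (by simp [n1, n2, n3]) ht
  -- all colors
  have hcol : colors c W ⊆ colors c A ∪ {c s(x₂, x₃), c s(x₁, x₃), c s(x₁, x₂)} := by
    intro κ hκ
    obtain ⟨e, he, rfl⟩ := Finset.mem_image.1 hκ
    have key : ∀ x y, x ∈ W → y ∈ W → x ≠ y → (x ∈ A → y ∈ A) →
        c s(x, y) ∈ colors c A ∪ {c s(x₂, x₃), c s(x₁, x₃), c s(x₁, x₂)} := by
      intro x y hx hy hxy hA'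
      have hxA : x ∈ A ∨ x = x₁ ∨ x = x₂ ∨ x = x₃ := by
        simp only [hA, Finset.mem_sdiff, Finset.mem_insert, Finset.mem_singleton]; tauto
      have hyA : y ∈ A ∨ y = x₁ ∨ y = x₂ ∨ y = x₃ := by
        simp only [hA, Finset.mem_sdiff, Finset.mem_insert, Finset.mem_singleton]; tauto
      rcases hxA with hxA | rfl | rfl | rfl
      · exact Finset.mem_union_left _ (mem_colors hxA (hA' hxA) hxy)
      all_goals
        apply Finset.mem_union_right
        simp only [Finset.mem_insert, Finset.mem_singleton]
        rcases hyA with hyA | rfl | rfl | rfl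
      all_goals first
        | exact absurd rfl hxy
        | (rw [e1 _ hyA]; simp)
        | (rw [e2 _ hyA]; simp)
        | (rw [e3 _ hyA]; simp)
        | simp [Sym2.eq_swap]
    revert he
    induction e with
    | _ x y =>
      intro he
      obtain ⟨hx, hy, hxy⟩ := mk_mem_pairs.1 he
      by_cases h : x ∈ A → y ∈ A
      · exact key x y hx hy hxy h
      · rw [Sym2.eq_swap (a := x)]
        exact key y x hy hx hxy.symm (by tauto)
  have hcA : (colors c A).card ≤ (τ + 1) * (2 * τ + 3) := by
    refine (card_colors_le c A).trans ?_
    rw [hcard]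
    have := two_mul_choose_two (2 * (τ + 1) + 1)
    nlinarith
  have hcW := (Finset.card_le_card hcol).trans (Finset.card_union_le _ _)
  -- not all three colors are different
  have htwo : c s(x₂, x₃) = c s(x₁, x₃) ∨ c s(x₂, x₃) = c s(x₁, x₂) ∨
      c s(x₁, x₃) = c s(x₁, x₂) := by
    by_contra hcon
    push Not at hcon
    -- If the three colors differed, the edges xᵢyᵢ would carry them, and a robust matching of the
    -- remaining 2τ vertices of A would add τ edges.
    obtain ⟨y₁, y₂, y₃, hy₁, hy₂, hy₃, hy12, hy13, hy23⟩ :=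
      Finset.two_lt_card_iff.1 (by omega : 2 < A.card)
    have hys : ({y₁, y₂, y₃} : Finset V) ⊆ A := by
      intro z hz
      simp only [Finset.mem_insert, Finset.mem_singleton] at hz
      rcases hz with rfl | rfl | rfl <;> assumption
    obtain ⟨M, m1, m2, m3, m4, m5⟩ := hR (A \ {y₁, y₂, y₃}) Finset.sdiff_subset τ
      (by rw [Finset.card_sdiff_of_subset hys, hcard,
            Finset.card_eq_three.2 ⟨y₁, y₂, y₃, hy12, hy13, hy23, rfl⟩]; omega) hτ
      {c s(x₂, x₃), c s(x₁, x₃), c s(x₁, x₂)} Finset.card_le_three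
    have hcM := cov_subset m1
    have hx : ∀ x, x ∉ A → x ∉ cov M := fun x hx h => hx (Finset.mem_sdiff.1 (hcM h)).1
    have hyM : ∀ y ∈ ({y₁, y₂, y₃} : Finset V), y ∉ cov M := fun y hy h =>
      (Finset.mem_sdiff.1 (hcM h)).2 hy
    have hxy : ∀ x, x ∉ A → ∀ y ∈ A, x ≠ y := fun x hx y hy h => hx (h ▸ hy)
    have k1 := m2.insert_edge (hx _ n1) (hyM y₁ (by simp)) (hxy _ n1 _ hy₁)
    have k2 : insert s(x₁, y₁) M ⊆ pairs W := Finset.insert_subset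
      (mk_mem_pairs.2 ⟨h1, hAW hy₁, hxy _ n1 _ hy₁⟩)
      (m1.trans (pairs_mono (Finset.sdiff_subset.trans hAW)))
    have k3 := rainbow_insert m3 (e := s(x₁, y₁)) (by
      intro h; obtain ⟨e, he, hce⟩ := Finset.mem_image.1 h
      exact m5 e he (by rw [hce, e1 _ hy₁]; simp))
    have h4 := hasRM_add_two (W := W) (U := W \ {x₂, y₂, x₃, y₃}) (M := insert s(x₁, y₁) M)
      (x := x₂) (y := y₂) (z := x₃) (w := y₃) ?_ k1 k3 Finset.sdiff_subset ?_ ?_ ?_ ?_ ?_ ?_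
    · rw [card_insert_edge (hx _ n1), m4] at h4
      exact hno h4
    · intro e he
      have hcov : cov (insert s(x₁, y₁) M) ⊆ W \ {x₂, y₂, x₃, y₃} := by
        rw [cov_insert]
        have q1 := hxy _ n1 _ hy₂
        have q2 := hxy _ n1 _ hy₃
        have q3 := hxy _ n2 _ hy₁
        have q4 := hxy _ n3 _ hy₁
        intro z hz
        simp only [Finset.mem_insert] at hz
        rcases hz with rfl | rfl | hz
        · simp [h1, h12, h13, q1, q2]
        · simp [hAW hy₁, hy12, hy13, q3.symm, q4.symm]
        · have hz1 := hcM hz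
          simp only [Finset.mem_sdiff, Finset.mem_insert, Finset.mem_singleton] at hz1 ⊢
          have r1 : z ≠ x₂ := fun h => n2 (h ▸ hz1.1)
          have r2 : z ≠ x₃ := fun h => n3 (h ▸ hz1.1)
          have r3 := hAW hz1.1
          tauto
      have hnd := not_isDiag_of_mem_pairs (k2 he)
      revert he hnd
      induction e with
      | _ p q =>
        intro he hnd
        exact mk_mem_pairs.2 ⟨hcov (mem_cov.2 ⟨_, he, by simp⟩),
          hcov (mem_cov.2 ⟨_, he, by simp⟩), by simpa using hnd⟩
    · simp [h23, hxy _ n2 _ hy₂, hxy _ n2 _ hy₃, (hxy _ n3 _ hy₂).symm, hy23, hxy _ n3 _ hy₃]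
    · simp [h2, h3, hAW hy₂, hAW hy₃]
    · simp
    · intro e he h
      rw [e2 _ hy₂] at h
      rcases Finset.mem_insert.1 he with rfl | he
      · rw [e1 _ hy₁] at h; exact hcon.1 h
      · exact m5 e he (by rw [h]; simp)
    · intro e he h
      rw [e3 _ hy₃] at h
      rcases Finset.mem_insert.1 he with rfl | he
      · rw [e1 _ hy₁] at h; exact hcon.2.1 h
      · exact m5 e he (by rw [h]; simp)
    · rw [e2 _ hy₂, e3 _ hy₃]; exact hcon.2.2
  have hS2 : ({c s(x₂, x₃), c s(x₁, x₃), c s(x₁, x₂)} : Finset K).card ≤ 2 := by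
    rcases htwo with h | h | h
    · rw [h, Finset.insert_idem]; exact Finset.card_le_two
    · rw [h, Finset.insert_comm, Finset.pair_eq_singleton]; exact Finset.card_le_two
    · rw [h, Finset.pair_eq_singleton]; exact Finset.card_le_two
  refine ⟨?_, by omega⟩
  -- The number of colors is large enough that the triangle has two colors, so a suitable naming of
  -- its vertices exists.
  by_cases g1 : c s(x₂, x₃) = c s(x₁, x₃)
  · by_cases g2 : c s(x₃, x₂) = c s(x₁, x₂)
    · exfalso
      have hS1 : ({c s(x₂, x₃), c s(x₁, x₃), c s(x₁, x₂)} : Finset K).card ≤ 1 := by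
        rw [← g1, ← g2, Sym2.eq_swap (a := x₃)]; simp
      omega
    · refine ⟨x₁, h1, x₃, h3, x₂, h2, h13, h12, h23.symm, g2, ?_⟩
      rwa [show ({x₁, x₃, x₂} : Finset V) = {x₁, x₂, x₃} by rw [Finset.pair_comm]]
  · exact ⟨x₁, h1, x₂, h2, x₃, h3, h12, h13, h23, g1, hR⟩

end EvenStructure

/-! ### The simultaneous induction for the matching bounds. -/

section EvenInduction

variable {V K : Type*} [DecidableEq V] [DecidableEq K]

/-- Without a rainbow perfect matching, a vertex `w` of small degree yields a vertex `x` of degree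
at most two, provided that `u` has no private color. -/
theorem exists_card_nbr_le_two {c : Sym2 V → K} {W : Finset V} {q : ℕ} (hW : W.card = 2 * q + 2)
    (hno : ¬ HasRM c W (q + 1)) {u w : V} (hu : u ∈ W) (hw : w ∈ W.erase u)
    {G : Finset (Sym2 V)} (hG : IsRep c (W.erase u) G)
    (hd : (2 * q).choose 2 + 8 + (nbr G w).card ≤ G.card + 4 * q) :
    ∃ x ∈ (W.erase u).erase w, (nbr G x).card ≤ 2 ∧
      G.card ≤ (nbr G w).card + 1 + (2 * q - 1).choose 2 := by
  set U := (W.erase u).erase w with hU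
  set H := G.filter fun e => e ∈ pairs U ∧ c e ≠ c s(u, w) with hH
  have hHU : H ⊆ pairs U := fun e he => (Finset.mem_filter.1 he).2.1
  have hUc : U.card = 2 * q := by
    rw [hU, Finset.card_erase_of_mem hw, Finset.card_erase_of_mem hu, hW]; omega
  have hone : (G.filter fun e => c e = c s(u, w)).card ≤ 1 := by
    rw [Finset.card_le_one]
    intro e he f hf
    rw [Finset.mem_filter] at he hf
    exact hG.inj he.1 hf.1 (he.2.trans hf.2.symm)
  have hGH : G.card ≤ H.card + (nbr G w).card + 1 := by
    have hcov : G ⊆ H ∪ (G.filter (w ∈ ·)) ∪ (G.filter fun e => c e = c s(u, w)) := by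
      intro e he
      have heW := hG.sub he
      by_cases h1 : c e = c s(u, w)
      · simp [he, h1]
      by_cases h2 : w ∈ e
      · simp [he, h2]
      have : e ∈ pairs U := by
        revert heW h2
        induction e with
        | _ x y =>
          simp only [mk_mem_pairs, Sym2.mem_iff, hU, Finset.mem_erase]
          tauto
      simp [hH, he, h1, this]
    have k1 := Finset.card_le_card hcov
    have k2 := Finset.card_union_le (H ∪ (G.filter (w ∈ ·))) (G.filter fun e => c e = c s(u, w))
    have k3 := Finset.card_union_le H (G.filter (w ∈ ·))
    rw [card_filter_mem] at k3
    omega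
  -- If H had no isolated vertex, it would have a perfect matching by `exists_perfect`, and uw would
  -- complete it to a rainbow one of W.
  have hiso : ∃ x ∈ U, nbr H x = ∅ := by
    by_contra hcon
    push Not at hcon
    obtain ⟨M, m1, m2, m3⟩ := exists_perfect hHU hUc hcon (by omega)
    have hcM := cov_subset (m1.trans hHU)
    have huw := Finset.mem_erase.1 hw
    refine hno (m3 ▸ HasRM.insert_edge (W := U) (W' := W) (x := u) (y := w) (m1.trans hHU) m2
      (hG.inj.mono (Finset.coe_subset.2 (m1.trans (Finset.filter_subset _ _))))
      ((Finset.erase_subset _ _).trans (Finset.erase_subset _ _)) hu huw.2 ?_ ?_ huw.1.symm ?_)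
    · intro h; have := hcM h; simp [hU] at this
    · intro h; have := hcM h; simp [hU] at this
    · intro h
      obtain ⟨e, he, hce⟩ := Finset.mem_image.1 h
      exact (Finset.mem_filter.1 (m1 he)).2.2 hce
  obtain ⟨x, hx, hxe⟩ := hiso
  refine ⟨x, hx, ?_, ?_⟩
  · rw [← card_filter_mem]
    -- As x is isolated in H, only xw and the representative of the color of uw can be edges of G at
    -- x.
    have hsub : G.filter (x ∈ ·) ⊆ {s(x, w)} ∪ (G.filter fun e => c e = c s(u, w)) := by
      intro e he
      obtain ⟨he, hxe'⟩ := Finset.mem_filter.1 he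
      by_cases h1 : c e = c s(u, w)
      · simp [he, h1]
      obtain ⟨y, rfl⟩ := Sym2.mem_iff_exists.1 hxe'
      obtain ⟨-, hy, hxy⟩ := mk_mem_pairs.1 (hG.sub he)
      by_cases hyw : y = w
      · simp [hyw]
      exfalso
      have : y ∈ nbr H x := by
        rw [mem_nbr, hH, Finset.mem_filter, mk_mem_pairs]
        exact ⟨he, ⟨hx, Finset.mem_erase.2 ⟨hyw, hy⟩, hxy⟩, h1⟩
      rw [hxe] at this
      simp at this
    have k1 := (Finset.card_le_card hsub).trans (Finset.card_union_le _ _)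
    rw [Finset.card_singleton] at k1
    omega
  · have h3 := card_le_sum_nbr_add (S := {x}) hHU
    rw [Finset.sum_singleton, hxe, Finset.card_sdiff_of_subset (by simpa using hx), hUc] at h3
    simp only [Finset.card_empty, Finset.card_singleton, zero_add] at h3
    omega

/-- A graph representing W − u also represents W. It has two vertices of degree at most two, and
deleting them leaves a clique on 2τ + 3 vertices with at most two edges missing. -/
theorem even_of_no_private {c : Sym2 V → K} {τ : ℕ} (hτ : 1 ≤ τ) (hT : MatchingBound c τ)
    {W : Finset V} (hW : W.card = 2 * τ + 6) (hb : Big (τ + 1) W.card (colors c W).card)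
    (hno : ¬ HasRM c W (τ + 3)) {u : V} (hu : u ∈ W)
    (hpz : colors c (W.erase u) = colors c W) :
    4 ≤ τ ∧ EvenExtremal c W ∧ (colors c W).card ≤ (τ + 1) * (2 * τ + 3) + 2 := by
  have hWu : (W.erase u).card = 2 * τ + 5 := by rw [Finset.card_erase_of_mem hu]; omega
  obtain ⟨hb1, hb2⟩ := hb
  rw [hW] at hb2
  obtain ⟨M, m1, m2, m3, m4⟩ := hT (W.erase u) (by omega) (by
    rw [hpz, hWu]; constructor <;> nlinarith)
  obtain ⟨G, hMG, hG⟩ := exists_isRep c (W.erase u) m1 m3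
  have hm : G.card = (colors c W).card := by rw [← card_colors_eq hG, hpz]
  have hGW : IsRep c W G := ⟨hG.sub.trans (pairs_mono (Finset.erase_subset _ _)), hG.inj,
    hG.img.trans hpz⟩
  have hcM := cov_subset m1
  have huM : u ∉ cov M := fun h => by have := hcM h; simp at this
  obtain ⟨v, hv⟩ : ((W.erase u) \ cov M).Nonempty := by
    rw [← Finset.card_pos, Finset.card_sdiff_of_subset hcM, m2.card_cov]; omega
  obtain ⟨hv1, hvM⟩ := Finset.mem_sdiff.1 hv
  obtain ⟨hvu, hvW⟩ := Finset.mem_erase.1 hv1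
  have hMW := m1.trans (pairs_mono (Finset.erase_subset u W))
  have hno' : ¬ HasRM c W (M.card + 1) := by rw [m4]; exact hno
  obtain ⟨a, b, hab, hcab⟩ := exists_color_eq hMW m2 m3 hno' hu hvW huM hvM hvu.symm
  obtain ⟨M', hM', e1, e2, e3, e4, e5, e6⟩ :=
    exchange hMW m2 m3 hab hcab hu hvW huM hvM hvu.symm
  set G' := insert s(u, v) (G.erase s(a, b)) with hG'
  have hGr : IsRep c W G' := hGW.exchange (hMG hab) (mk_mem_pairs.2 ⟨hu, hvW, hvu.symm⟩) hcab
  have hMG' : M' ⊆ G' := by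
    rw [hM', hG']; exact Finset.insert_subset_insert _ (Finset.erase_subset_erase _ hMG)
  have haM : a ∈ cov M := mem_cov.2 ⟨_, hab, by simp⟩
  have hbM : b ∈ cov M := mem_cov.2 ⟨_, hab, by simp⟩
  have ne : ∀ x ∈ cov M, x ≠ u ∧ x ≠ v := fun x hx =>
    ⟨fun h => huM (h ▸ hx), fun h => hvM (h ▸ hx)⟩
  have haM' : a ∉ cov M' := by rw [e6]; have := ne a haM; tauto
  have hbM' : b ∉ cov M' := by rw [e6]; have := ne b hbM; tauto
  have habn : a ≠ b := by simpa using m2.nd _ hab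
  have hsum := (nbr_add_nbr e2 hMG' (fun e he => not_isDiag_of_mem_pairs (hGr.sub he))
    (hGr.noBigger (by rw [e4]; exact hno')) haM' hbM' habn).1
  rw [e4, m4] at hsum
  have da := nbr_exchange (G := G) (b := b) (ne a haM).1 (ne a haM).2
  have db := nbr_exchange (G := G) (b := a) (ne b hbM).1 (ne b hbM).2
  rw [Sym2.eq_swap (a := b), ← hG'] at db
  rw [← hG'] at da
  have da' := Finset.pred_card_le_card_erase (s := nbr G a) (a := b)
  have db' := Finset.pred_card_le_card_erase (s := nbr G b) (a := a)
  rw [← da] at da'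
  rw [← db] at db'
  -- In the exchanged graph a and b have degree sum at most 2(τ + 2), and each has lost at most one
  -- edge.
  obtain ⟨w, hw, hdw⟩ : ∃ w ∈ W.erase u, (nbr G w).card ≤ τ + 3 := by
    by_cases h : (nbr G a).card ≤ τ + 3
    · exact ⟨a, hcM haM, h⟩
    · exact ⟨b, hcM hbM, by omega⟩
  have hch := two_mul_choose_two (2 * (τ + 2))
  have hch' := two_mul_choose_two (2 * τ + 3)
  have hch'' : (2 * (τ + 2) - 1).choose 2 = (2 * τ + 3).choose 2 := by congr 1
  have hnum : (2 * (τ + 2)).choose 2 + 8 + (τ + 3) ≤ G.card + 4 * (τ + 2) := by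
    rw [hm]
    rcases Nat.lt_or_ge τ 4 with h4 | h4
    · interval_cases τ <;> omega
    · nlinarith
  obtain ⟨b', hb', hdb', -⟩ := exists_card_nbr_le_two (q := τ + 2) (by omega) hno hu hw hG
    (by omega)
  have hb'u := (Finset.mem_erase.1 hb').2
  -- Using b' in the role of w yields a second vertex of degree at most two and bounds the number of
  -- colors by that of a clique on 2τ + 3 vertices plus three. For τ ≤ 3 the star term of `Big` is
  -- larger.
  obtain ⟨a', ha', hda', hle⟩ := exists_card_nbr_le_two (q := τ + 2) (by omega) hno hu hb'u hG
    (by omega)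
  rw [hch''] at hle
  have h4 : 4 ≤ τ := by
    by_contra h4
    push Not at h4
    interval_cases τ <;> omega
  refine ⟨h4, ?_⟩
  obtain ⟨ha'b, ha'u⟩ := Finset.mem_erase.1 ha'
  obtain ⟨hau, haW⟩ := Finset.mem_erase.1 ha'u
  obtain ⟨hbu, hbW⟩ := Finset.mem_erase.1 hb'u
  have hsub : ({u, a', b'} : Finset V) ⊆ W := by
    intro z hz
    simp only [Finset.mem_insert, Finset.mem_singleton] at hz
    rcases hz with rfl | rfl | rfl <;> assumption
  refine evenExtremal_of_robust h4 hW hno hb1 hu haW hbW hau.symm hbu.symm ha'b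
    (robust_of_card (G := G) hG.inj ?_)
  have hKc : (W \ {u, a', b'}).card = 2 * τ + 3 := by
    rw [Finset.card_sdiff_of_subset hsub, hW,
      Finset.card_eq_three.2 ⟨u, a', b', hau.symm, hbu.symm, ha'b, rfl⟩]
    omega
  have hcover : G ⊆ G.filter (· ∈ pairs (W \ {u, a', b'})) ∪ G.filter (a' ∈ ·) ∪
      G.filter (b' ∈ ·) := by
    intro e he
    have heW := hG.sub he
    by_cases h1 : a' ∈ e
    · simp [he, h1]
    by_cases h2 : b' ∈ e
    · simp [he, h2]
    have : e ∈ pairs (W \ {u, a', b'}) := by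
      revert heW h1 h2
      induction e with
      | _ x y =>
        simp only [mk_mem_pairs, Sym2.mem_iff, Finset.mem_sdiff, Finset.mem_erase,
          Finset.mem_insert, Finset.mem_singleton]
        intro h1 h2 h3
        refine ⟨⟨h1.1.2, ?_⟩, ⟨h1.2.1.2, ?_⟩, h1.2.2⟩
        · rintro (h | h | h)
          · exact h1.1.1 h
          · exact h2 (Or.inl h.symm)
          · exact h3 (Or.inl h.symm)
        · rintro (h | h | h)
          · exact h1.2.1.1 h
          · exact h2 (Or.inr h.symm)
          · exact h3 (Or.inr h.symm)
    simp [he, this]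
  have k1 := Finset.card_le_card hcover
  have k2 := Finset.card_union_le (G.filter (· ∈ pairs (W \ {u, a', b'})) ∪ G.filter (a' ∈ ·))
    (G.filter (b' ∈ ·))
  have k3 := Finset.card_union_le (G.filter (· ∈ pairs (W \ {u, a', b'}))) (G.filter (a' ∈ ·))
  rw [card_filter_mem] at k2 k3
  rw [card_pairs, hKc]
  have : (2 * τ + 3).choose 2 + 2 ≤ G.card := by rw [hm]; nlinarith
  omega

/-- The conclusion for colorings of complete graphs of even order. -/
def EvenBound (c : Sym2 V → K) (σ : ℕ) : Prop :=
  ∀ W : Finset V, W.card = 2 * σ + 4 → Big σ W.card (colors c W).card → ¬ HasRM c W (σ + 2) →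
    5 ≤ σ ∧ EvenExtremal c W ∧ (colors c W).card ≤ σ * (2 * σ + 1) + 2

/-- Either some vertex has no private color, which leads to the extremal structure, or every
representing graph has minimum degree at least τ + 2 and `hasRM_of_min_degree` applies. -/
theorem evenBound_succ {c : Sym2 V → K} {τ : ℕ} (hτ : 1 ≤ τ) (hT : MatchingBound c τ)
    (hE : 2 ≤ τ → EvenBound c τ) : EvenBound c (τ + 1) := by
  intro W hW hb hno
  have hW' : W.card = 2 * τ + 6 := by omega
  by_cases hpz : ∃ u ∈ W, colors c (W.erase u) = colors c W
  · obtain ⟨u, hu, hpz⟩ := hpz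
    obtain ⟨h1, h2, h3⟩ := even_of_no_private hτ hT hW' hb hno hu hpz
    exact ⟨by omega, h2, by linarith⟩
  exfalso
  push Not at hpz
  refine hno (hasRM_of_min_degree (σ := τ + 1) hW (hT W (by omega) (hb.of_succ (by omega))) ?_)
  intro G hG z hz
  obtain ⟨y, hy, hyz, hyG, hle, hno'⟩ := exists_private_nbr hG hz (s := τ + 2) hno (hpz z hz)
  have hdy := card_nbr_lt hG.sub hy
  have hc : ((W.erase z).erase y).card = 2 * τ + 4 := by
    rw [Finset.card_erase_of_mem (Finset.mem_erase.2 ⟨hyz, hy⟩), Finset.card_erase_of_mem hz]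
    omega
  set m' := (colors c ((W.erase z).erase y)).card
  obtain ⟨hb1, hb2⟩ := hb
  -- After deletion of a private edge with its ends, even an extremal coloring has at most two
  -- colors beyond the clique. For τ = 1 the rest has six vertices.
  have key : m' ≤ τ * (2 * τ + 1) + 2 ∨ 2 * m' + τ * (τ + 1) ≤ 2 * τ * (2 * τ + 4) + 3 := by
    rcases Nat.lt_or_ge τ 2 with h2 | h2
    · obtain rfl : τ = 1 := by omega
      right
      by_contra hcon
      exact hno' (hasRM_three hc (by omega))
    · by_cases hB : Big τ ((W.erase z).erase y).card m'
      · exact Or.inl (hE h2 _ hc hB hno').2.2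
      · rw [hc, Big, not_and_or] at hB
        rcases hB with hB | hB
        · left; omega
        · right; omega
  by_contra hlt
  push Not at hlt
  rw [hW'] at hb2
  rcases key with key | key
  · nlinarith
  · rcases Nat.lt_or_ge τ 3 with h3 | h3
    · obtain rfl | rfl : τ = 1 ∨ τ = 2 := by omega
      · omega
      · omega
    · nlinarith

/-- The two bounds feed each other: the even bound for σ + 1 needs the matching bound for σ, and the
matching bound for σ + 1 falls back on the even bound for σ + 1 at order 2σ + 7. The case of six
vertices is replaced by `hasRM_three`. -/
theorem bounds (c : Sym2 V → K) (σ : ℕ) :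
    MatchingBound c σ ∧ (2 ≤ σ → EvenBound c σ) := by
  induction σ with
  | zero => exact ⟨matchingBound_zero c, by omega⟩
  | succ σ ih =>
    have hE : 2 ≤ σ + 1 → EvenBound c (σ + 1) := fun h => evenBound_succ (by omega) ih.1 ih.2
    refine ⟨matchingBound_succ ih.1 ?_, hE⟩
    rintro W hW hb ⟨u, hu, hpz⟩
    have hc : (W.erase u).card = 2 * σ + 6 := by rw [Finset.card_erase_of_mem hu]; omega
    by_contra hno
    have hno' : ¬ HasRM c (W.erase u) (σ + 3) := fun h => hno (h.mono (Finset.erase_subset _ _))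
    obtain ⟨hb1, hb2⟩ := hb
    rcases Nat.lt_or_ge σ 1 with h0 | h0
    · obtain rfl : σ = 0 := by omega
      exact hno' (hasRM_three hc (by rw [hpz]; rw [hW] at hb2; omega))
    · obtain ⟨h5, hX, -⟩ := hE (by omega) (W.erase u) (by omega)
        (by rw [hpz, hc]; rw [hW] at hb2; constructor <;> nlinarith) hno'
      exact hno (hasRM_of_evenExtremal (j := σ + 1) (by omega) (by omega) hu hX)

end EvenInduction

/-! ### Building the linear forest around a matching. -/

section Forest

variable {V : Type*} [DecidableEq V]

/-- The graph with edge set `G` contains the linear forest `k P₄ ∪ t P₂`. -/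
def ContainsForest (G : Finset (Sym2 V)) (k t : ℕ) : Prop :=
  ∃ f : (Fin k × Fin 4) ⊕ (Fin t × Fin 2) → V, Function.Injective f ∧
    ∀ x y, (linearForest k t).Adj x y → s(f x, f y) ∈ G

/-- Complete `k` disjoint paths by `t` edges of a matching that they do not meet. -/
theorem containsForest_of_paths {M G M₁ : Finset (Sym2 V)} (hM : IsMatch M) (hMG : M ⊆ G)
    {k t : ℕ} {p : Fin k × Fin 4 → V} (hp : Function.Injective p)
    (h01 : ∀ i, s(p (i, 0), p (i, 1)) ∈ G) (h12 : ∀ i, s(p (i, 1), p (i, 2)) ∈ G)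
    (h23 : ∀ i, s(p (i, 2), p (i, 3)) ∈ G) (hM₁ : M₁.card + t ≤ M.card)
    (h : ∀ x, ∀ f ∈ M, p x ∈ f → f ∈ M₁) : ContainsForest G k t := by
  have hle := Finset.le_card_sdiff M₁ M
  obtain ⟨M₂, hM₂, hc⟩ := Finset.exists_subset_card_eq (show t ≤ (M \ M₁).card by omega)
  have e : Fin t ≃ M₂ := (M₂.equivFinOfCardEq hc).symm
  have hab : ∀ j, ∃ ab : V × V, (e j : Sym2 V) = s(ab.1, ab.2) := fun j => by
    induction (e j : Sym2 V) with
    | _ x y => exact ⟨(x, y), rfl⟩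
  choose ab hab using hab
  have heM : ∀ j, s((ab j).1, (ab j).2) ∈ M := fun j => by
    rw [← hab]; exact (Finset.mem_sdiff.1 (hM₂ (e j).2)).1
  have heM₁ : ∀ j, s((ab j).1, (ab j).2) ∉ M₁ := fun j => by
    rw [← hab]; exact (Finset.mem_sdiff.1 (hM₂ (e j).2)).2
  set q : Fin t × Fin 2 → V := fun x => if x.2 = 0 then (ab x.1).1 else (ab x.1).2 with hq
  have hqm : ∀ x, q x ∈ s((ab x.1).1, (ab x.1).2) := by
    intro x
    by_cases hx : x.2 = 0 <;> simp [hq, hx]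
  refine ⟨Sum.elim p q, hp.sumElim ?_ ?_, ?_⟩
  · rintro ⟨i, a⟩ ⟨j, b⟩ hxy
    have h1 := hqm (i, a)
    have h2 := hqm (j, b)
    rw [hxy] at h1
    have h3 := hM.disj _ (heM i) _ (heM j) _ h1 h2
    rw [← hab, ← hab] at h3
    obtain rfl := e.injective (Subtype.ext h3)
    have hne : (ab i).1 ≠ (ab i).2 := by simpa using hM.nd _ (heM i)
    revert hxy
    fin_cases a <;> fin_cases b <;> simp [hq, hne, hne.symm]
  · intro x y hxy
    have h1 := hqm y
    rw [← hxy] at h1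
    exact heM₁ _ (h x _ (heM _) h1)
  · rintro (⟨i, a⟩ | ⟨i, a⟩) (⟨j, b⟩ | ⟨j, b⟩) hadj
    · obtain ⟨rfl, hadj⟩ : i = j ∧ (pathGraph 4).Adj a b := hadj
      rw [pathGraph_adj] at hadj
      simp only [Sum.elim_inl]
      fin_cases a <;> fin_cases b <;> simp at hadj <;>
        first
        | exact h01 i
        | exact h12 i
        | exact h23 i
        | (rw [Sym2.eq_swap]; first | exact h01 i | exact h12 i | exact h23 i)
    · simp [linearForest] at hadj
    · simp [linearForest] at hadj
    · obtain ⟨rfl, hadj⟩ : i = j ∧ (pathGraph 2).Adj a b := hadj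
      rw [pathGraph_adj] at hadj
      simp only [Sum.elim_inr]
      have := hMG (heM i)
      fin_cases a <;> fin_cases b <;> simp at hadj
      · simpa [hq] using this
      · rw [Sym2.eq_swap]; simpa [hq] using this

/-- A bound for the number of edges of a graph without `κ + 1` disjoint edges. -/
theorem card_le_of_no_match {Γ : Finset (Sym2 V)} {A : Finset V} (hΓ : Γ ⊆ pairs A) {κ : ℕ}
    (hA : 3 * κ + 4 ≤ A.card) (hno : ∀ N ⊆ Γ, IsMatch N → N.card ≠ κ + 1) :
    2 * Γ.card + κ * (κ + 1) ≤ 2 * κ * A.card + 3 * κ := by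
  rcases Nat.eq_zero_or_pos κ with rfl | hκ
  · have : Γ = ∅ := by
      by_contra hne
      obtain ⟨e, he⟩ := Finset.nonempty_iff_ne_empty.2 hne
      refine hno {e} (by simpa using he) ⟨?_, ?_⟩ (by simp)
      · intro f hf
        rw [Finset.mem_singleton.1 hf]
        exact not_isDiag_of_mem_pairs (hΓ he)
      · intro f hf g hg _ _ _
        rw [Finset.mem_singleton.1 hf, Finset.mem_singleton.1 hg]
    simp [this]
  by_contra hlt
  push Not at hlt
  -- A rainbow matching of size κ + 2 uses the common color `none` at most once, so it has κ + 1
  -- edges in Γ. The slack 3κ absorbs the constants in `Big`.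
  set c : Sym2 V → Option (Sym2 V) := fun e => if e ∈ Γ then some e else none with hc
  have hcol : Γ.card ≤ (colors c A).card := by
    rw [← Finset.card_image_of_injOn (f := c) (s := Γ)]
    · exact Finset.card_le_card (Finset.image_subset_image hΓ)
    · intro e he f hf hef
      simpa [hc, Finset.mem_coe.1 he, Finset.mem_coe.1 hf] using hef
  obtain ⟨M, m1, m2, m3, m4⟩ := (bounds c κ).1 A (by omega) (by
    constructor
    · nlinarith
    · omega)
  have h1 : (M.filter (· ∉ Γ)).card ≤ 1 := by
    rw [Finset.card_le_one]
    intro e he f hf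
    rw [Finset.mem_filter] at he hf
    exact m3 he.1 hf.1 (by simp [hc, he.2, hf.2])
  have h2 := Finset.card_filter_add_card_filter_not (s := M) (· ∈ Γ)
  obtain ⟨N, hN, hNc⟩ := Finset.exists_subset_card_eq
    (show κ + 1 ≤ (M.filter (· ∈ Γ)).card by omega)
  exact hno N (hN.trans fun e he => (Finset.mem_filter.1 he).2)
    (m2.mono (hN.trans (Finset.filter_subset _ _))) hNc

theorem card_le_sum_nbr_add_filter {G : Finset (Sym2 V)} {W S : Finset V} (hG : G ⊆ pairs W) :
    G.card ≤ ∑ x ∈ S, (nbr G x).card + (G.filter (· ∈ pairs (W \ S))).card := by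
  have h : G ⊆ (S.biUnion fun x => G.filter (x ∈ ·)) ∪ G.filter (· ∈ pairs (W \ S)) := by
    intro e he
    by_cases h : ∃ x ∈ S, x ∈ e
    · obtain ⟨x, hx, hxe⟩ := h
      exact Finset.mem_union_left _ (Finset.mem_biUnion.2 ⟨x, hx, by simp [he, hxe]⟩)
    · push Not at h
      have heW := hG he
      have : e ∈ pairs (W \ S) := by
        revert heW h
        induction e with
        | _ x y =>
          simp only [mk_mem_pairs, Sym2.mem_iff, Finset.mem_sdiff]
          intro h1 h2
          exact ⟨⟨h2.1, fun h => h1 x h (Or.inl rfl)⟩, ⟨h2.2.1, fun h => h1 y h (Or.inr rfl)⟩,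
            h2.2.2⟩
      exact Finset.mem_union_right _ (Finset.mem_filter.2 ⟨he, this⟩)
  refine (Finset.card_le_card h).trans ((Finset.card_union_le _ _).trans ?_)
  refine Nat.add_le_add_right (Finset.card_biUnion_le.trans ?_) _
  exact Finset.sum_le_sum fun x _ => (card_filter_mem G x).le

section Mates

variable {M G : Finset (Sym2 V)} {μ : V → V}

theorem edge_eq_of_mate (hM : IsMatch M) (h1 : ∀ x ∈ cov M, s(x, μ x) ∈ M) {f : Sym2 V}
    (hf : f ∈ M) {x : V} (hx : x ∈ f) : f = s(x, μ x) :=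
  hM.disj _ hf _ (h1 x (mem_cov.2 ⟨f, hf, hx⟩)) x hx (by simp)

/-- Paths through the middle of two joined matching edges. -/
theorem containsForest_of_joined (hM : IsMatch M) (hMG : M ⊆ G)
    (h1 : ∀ x ∈ cov M, s(x, μ x) ∈ M) (h2 : ∀ x ∈ cov M, μ x ∈ cov M)
    (h3 : ∀ x ∈ cov M, μ (μ x) = x) (h4 : ∀ x ∈ cov M, μ x ≠ x) {k t : ℕ}
    (hc : 2 * k + t ≤ M.card) {N : Finset (Sym2 (Sym2 V))} (hN : IsMatch N) (hNk : N.card = k)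
    (hj : ∀ g ∈ N, ∃ x ∈ cov M, ∃ y ∈ cov M, s(x, y) ∈ G ∧ g = s(s(x, μ x), s(y, μ y))) :
    ContainsForest G k t := by
  have e : Fin k ≃ N := (N.equivFinOfCardEq hNk).symm
  choose x hx y hy hG hg using fun i => hj (e i) (e i).2
  have hne : ∀ i, s(x i, μ (x i)) ≠ s(y i, μ (y i)) := fun i h => by
    have := hN.nd _ (e i).2
    rw [hg, h] at this
    simp at this
  set p : Fin k × Fin 4 → V := fun w => ![μ (x w.1), x w.1, y w.1, μ (y w.1)] w.2 with hp
  have hpc : ∀ w, p w ∈ cov M := by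
    rintro ⟨i, a⟩
    fin_cases a <;> simp only [hp]
    · exact h2 _ (hx i)
    · exact hx i
    · exact hy i
    · exact h2 _ (hy i)
  have hF : ∀ w, s(p w, μ (p w)) ∈ (e w.1 : Sym2 (Sym2 V)) := by
    rintro ⟨i, a⟩
    rw [hg, Sym2.mem_iff]
    fin_cases a <;> simp [hp, h3 _ (hx i), h3 _ (hy i), Sym2.eq_swap]
  refine containsForest_of_paths hM hMG (p := p)
    (M₁ := (Finset.univ.image fun i => s(x i, μ (x i))) ∪
      Finset.univ.image fun i => s(y i, μ (y i))) ?_ ?_ ?_ ?_ ?_ ?_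
  · rintro ⟨i, a⟩ ⟨j, b⟩ hab
    have k1 := hF (i, a)
    rw [hab] at k1
    have k2 := hN.disj _ (e i).2 _ (e j).2 _ k1 (hF (j, b))
    obtain rfl := e.injective (Subtype.ext k2)
    have q1 := h4 _ (hx i)
    have q2 := h4 _ (hy i)
    have q3 : x i ≠ y i := fun h => hne i (by rw [h])
    have q4 : x i ≠ μ (y i) := fun h => hne i (by rw [h, h3 _ (hy i), Sym2.eq_swap])
    have q5 : μ (x i) ≠ y i := fun h => hne i (by rw [← h, h3 _ (hx i), Sym2.eq_swap])
    have q6 : μ (x i) ≠ μ (y i) := fun h => hne i (by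
      have : x i = y i := by rw [← h3 _ (hx i), h, h3 _ (hy i)]
      rw [this])
    revert hab
    fin_cases a <;> fin_cases b <;>
      simp [hp, q1, q2, q3, q4, q5, q6, q1.symm, q2.symm, q3.symm, q4.symm, q5.symm, q6.symm]
  · intro i; rw [Sym2.eq_swap]; exact hMG (h1 _ (hx i))
  · exact hG
  · intro i; exact hMG (h1 _ (hy i))
  · have k1 := Finset.card_union_le (Finset.univ.image fun i => s(x i, μ (x i)))
      (Finset.univ.image fun i => s(y i, μ (y i)))
    have k2 := Finset.card_image_le (s := Finset.univ) (f := fun i => s(x i, μ (x i)))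
    have k3 := Finset.card_image_le (s := Finset.univ) (f := fun i => s(y i, μ (y i)))
    rw [Finset.card_univ, Fintype.card_fin] at k2 k3
    omega
  · intro w f hf hw
    rw [edge_eq_of_mate hM h1 hf hw]
    have := hF w
    rw [hg, Sym2.mem_iff] at this
    rw [Finset.mem_union, Finset.mem_image, Finset.mem_image]
    rcases this with h | h
    · exact Or.inl ⟨_, Finset.mem_univ _, h.symm⟩
    · exact Or.inr ⟨_, Finset.mem_univ _, h.symm⟩

/-- Paths through uncovered vertices that have neighbours on many matching edges. -/
theorem containsForest_of_uncovered (hM : IsMatch M) (hMG : M ⊆ G)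
    (h1 : ∀ x ∈ cov M, s(x, μ x) ∈ M) (h2 : ∀ x ∈ cov M, μ x ∈ cov M)
    (h3 : ∀ x ∈ cov M, μ (μ x) = x) (h4 : ∀ x ∈ cov M, μ x ≠ x) {k t : ℕ}
    (hc : 2 * k + t ≤ M.card) {B : Finset V} (hB : k ≤ B.card) (hBM : ∀ z ∈ B, z ∉ cov M)
    (hd : ∀ z ∈ B, 2 * k ≤ (((nbr G z).filter (· ∈ cov M)).image fun x => s(x, μ x)).card) :
    ContainsForest G k t := by
  obtain ⟨B', hB', hBk⟩ := Finset.exists_subset_card_eq hB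
  have e : Fin k ≃ B' := (B'.equivFinOfCardEq hBk).symm
  set T : Fin k ⊕ Fin k → Finset (Sym2 V) := fun i =>
    ((nbr G (Sum.elim (fun i => (e i : V)) (fun i => (e i : V)) i)).filter
      (· ∈ cov M)).image fun x => s(x, μ x) with hT
  have hTc : ∀ i, 2 * k ≤ (T i).card := by
    rintro (i | i)
    · exact hd _ (hB' (e i).2)
    · exact hd _ (hB' (e i).2)
  -- Each z needs two matching edges of its own. Hall's condition for the 2k demands is immediate,
  -- as every single set has at least 2k elements.
  obtain ⟨f, hf, hfT⟩ := (Finset.all_card_le_biUnion_card_iff_exists_injective T).1 (by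
    intro s
    rcases s.eq_empty_or_nonempty with rfl | ⟨i, hi⟩
    · simp
    · have k1 : s.card ≤ 2 * k := by
        have := Finset.card_le_univ s
        simp only [Fintype.card_sum, Fintype.card_fin] at this
        omega
      exact k1.trans ((hTc i).trans (Finset.card_le_card (Finset.subset_biUnion_of_mem T hi))))
  have hex : ∀ i, ∃ x ∈ cov M, s((Sum.elim (fun i => (e i : V)) (fun i => (e i : V)) i), x) ∈ G ∧
      s(x, μ x) = f i := by
    intro i
    obtain ⟨x, hx, hxf⟩ := Finset.mem_image.1 (hfT i)
    rw [Finset.mem_filter, mem_nbr] at hx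
    exact ⟨x, hx.2, hx.1, hxf⟩
  choose x hx hxG hxf using hex
  have hz : ∀ i, (e i : V) ∉ cov M := fun i => hBM _ (hB' (e i).2)
  set p : Fin k × Fin 4 → V := fun w =>
    ![μ (x (Sum.inl w.1)), x (Sum.inl w.1), (e w.1 : V), x (Sum.inr w.1)] w.2 with hp
  have hF : ∀ w, (w.2 = 2 ∧ p w ∉ cov M ∧ p w = e w.1) ∨ (w.2 ≠ 2 ∧ p w ∈ cov M ∧
      (s(p w, μ (p w)) = f (Sum.inl w.1) ∧ w.2 ≠ 3 ∨
        s(p w, μ (p w)) = f (Sum.inr w.1) ∧ w.2 = 3)) := by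
    rintro ⟨i, a⟩
    fin_cases a
    · right
      refine ⟨by simp, h2 _ (hx _), Or.inl ⟨?_, by simp⟩⟩
      rw [← hxf]
      simp [hp, h3 _ (hx _), Sym2.eq_swap]
    · right
      exact ⟨by simp, hx _, Or.inl ⟨hxf _, by simp⟩⟩
    · left
      exact ⟨rfl, hz i, rfl⟩
    · right
      exact ⟨by simp, hx _, Or.inr ⟨hxf _, rfl⟩⟩
  refine containsForest_of_paths hM hMG (p := p) (M₁ := Finset.univ.image f) ?_ ?_ ?_ ?_ ?_ ?_
  · rintro ⟨i, a⟩ ⟨j, b⟩ hab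
    rcases hF (i, a) with ⟨a1, a2, a3⟩ | ⟨a1, a2, a3⟩ <;>
      rcases hF (j, b) with ⟨b1, b2, b3⟩ | ⟨b1, b2, b3⟩
    · rw [hab, b3] at a3
      obtain rfl := e.injective (Subtype.ext a3)
      simp only at a1 b1
      rw [a1, b1]
    · rw [hab] at a2; exact absurd b2 a2
    · rw [hab] at a2; exact absurd a2 b2
    · rw [hab] at a3
      rcases a3 with ⟨a3, a4⟩ | ⟨a3, a4⟩ <;> rcases b3 with ⟨b3, b4⟩ | ⟨b3, b4⟩ <;>
        have hij := hf (a3.symm.trans b3) <;> simp at hij <;> subst hij <;> simp only at a4 b4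
      · have q := h4 _ (hx (Sum.inl i))
        simp only at a1 b1
        revert hab a1 b1 a4 b4
        clear a3 b3 a2 b2
        fin_cases a <;> fin_cases b <;> simp [hp, q, q.symm]
      · rw [a4, b4]
  · intro i; rw [Sym2.eq_swap]; exact hMG (h1 _ (hx _))
  · intro i; rw [Sym2.eq_swap]; exact hxG (Sum.inl i)
  · intro i; exact hxG (Sum.inr i)
  · have k2 := Finset.card_image_le (s := Finset.univ) (f := f)
    rw [Finset.card_univ, Fintype.card_sum, Fintype.card_fin] at k2
    omega
  · intro w g hg hw
    rw [edge_eq_of_mate hM h1 hg hw]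
    rcases hF w with ⟨-, a2, -⟩ | ⟨-, -, ⟨h, -⟩ | ⟨h, -⟩⟩
    · exact absurd (mem_cov.2 ⟨g, hg, hw⟩) a2
    · rw [h]; exact Finset.mem_image_of_mem _ (Finset.mem_univ _)
    · rw [h]; exact Finset.mem_image_of_mem _ (Finset.mem_univ _)

end Mates

end Forest

/-! ### Counting edges around a maximum matching. -/

section ForestCount

variable {V : Type*} [DecidableEq V]

/-- Up to terms without n, r and u, the upper bound for 2g is (10κ + 6)r + (4κ + 2)u ≤ (5κ + 3)n,
while the lower bound has leading term 2(2κ + t)n ≥ (6κ + 4)n. The bound on n makes the difference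
beat the terms quadratic in κ and t. -/
theorem forest_arithmetic {κ t r n g γ u d : ℕ} (ht : κ + 2 ≤ t) (hn : 8 * κ + 2 * t + 4 ≤ n)
    (hr : 2 * (κ + 1) + t ≤ r) (hu : 2 * r + u = n)
    (hg : 2 * (2 * κ + t) * n + 4 ≤ 2 * g + (2 * κ + t) * (2 * κ + t + 1))
    (hγ : 2 * γ + κ * (κ + 1) ≤ 2 * κ * r + 3 * κ)
    (hd : d + κ * (2 * κ + 1) ≤ 2 * r + u * (2 * κ + 1) + κ * r)
    (hgd : g ≤ d + (r + 4 * γ)) : False := by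
  obtain ⟨a, rfl⟩ : ∃ a, t = κ + 2 + a := ⟨t - (κ + 2), by omega⟩
  obtain ⟨b, rfl⟩ : ∃ b, n = 10 * κ + 8 + 2 * a + b := ⟨n - (10 * κ + 8 + 2 * a), by omega⟩
  have hrn : 2 * r ≤ 10 * κ + 8 + 2 * a + b := by omega
  obtain ⟨w, hw⟩ : ∃ w, 2 * r + w = 10 * κ + 8 + 2 * a + b := ⟨_, Nat.add_sub_cancel' hrn⟩
  obtain rfl : u = w := by omega
  zify at *
  have p1 : (0 : ℤ) ≤ κ * a := by positivity
  have p2 : (0 : ℤ) ≤ (a : ℤ) * a := by positivity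
  have p3 : (0 : ℤ) ≤ (κ : ℤ) * b := by positivity
  have p4 : (0 : ℤ) ≤ (a : ℤ) * b := by positivity
  have p5 : (0 : ℤ) ≤ (κ : ℤ) * u := by positivity
  have p6 : (0 : ℤ) ≤ (κ : ℤ) * κ := by positivity
  have hκ : (0 : ℤ) ≤ κ := by positivity
  have p7 : (κ : ℤ) ≤ κ * κ := by
    rcases Nat.eq_zero_or_pos κ with rfl | h
    · simp
    · have : (1 : ℤ) ≤ κ := by exact_mod_cast h
      nlinarith
  have hu0 : (0 : ℤ) ≤ u := by positivity
  nlinarith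

/-- Contract the edges of M: κ + 1 disjoint edges of the contracted graph Γ give the paths, so
otherwise Γ is sparse. The neighbours of an uncovered z split into `D z`, where the mate is a
neighbour too, and `S z`. The sets `D z` are disjoint by maximality of M, and κ + 1 large sets `S z`
would again give the paths. -/
theorem containsForest_of_card {W : Finset V} {M G : Finset (Sym2 V)} (hG : G ⊆ pairs W)
    (hM : IsMatch M) (hMG : M ⊆ G) (hNB : NoBigger M G) {κ t : ℕ} (ht : κ + 2 ≤ t)
    (hn : 8 * κ + 2 * t + 4 ≤ W.card) (hr : 2 * (κ + 1) + t ≤ M.card)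
    (hg : 2 * (2 * κ + t) * W.card + 4 ≤ 2 * G.card + (2 * κ + t) * (2 * κ + t + 1)) :
    ContainsForest G (κ + 1) t := by
  by_contra hno
  obtain ⟨μ, h1, h2, h3, h4, h5⟩ := hM.exists_mate
  have hnd : ∀ e ∈ G, ¬ e.IsDiag := fun e he => not_isDiag_of_mem_pairs (hG he)
  have hcW : cov M ⊆ W := cov_subset (hMG.trans hG)
  have hWc : W \ (W \ cov M) = cov M := Finset.sdiff_sdiff_eq_self hcW
  have hZM : ∀ z ∈ W \ cov M, z ∉ cov M := fun z hz => (Finset.mem_sdiff.1 hz).2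
  have hsplit := card_le_sum_nbr_add_filter (S := W \ cov M) hG
  rw [hWc] at hsplit
  set F : V → Sym2 V := fun x => s(x, μ x) with hF
  have hFeq : ∀ x ∈ cov M, ∀ y ∈ cov M, F x = F y → y = x ∨ y = μ x := by
    intro x hx y hy hxy
    have : y ∈ F x := by rw [hxy]; simp [hF]
    simpa [hF] using this
  -- the edges between different edges of `M`
  set J := (G.filter (· ∈ pairs (cov M))) \ M with hJ
  set Γ := J.image (Sym2.map F) with hΓ
  have hJm : ∀ x y, s(x, y) ∈ J → s(x, y) ∈ G ∧ x ∈ cov M ∧ y ∈ cov M ∧ F x ≠ F y := by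
    intro x y hxy
    rw [hJ, Finset.mem_sdiff, Finset.mem_filter, mk_mem_pairs] at hxy
    obtain ⟨⟨a1, a2, a3, a4⟩, a5⟩ := hxy
    refine ⟨a1, a2, a3, fun h => ?_⟩
    rcases hFeq x a2 y a3 h with h | h
    · exact a4 h.symm
    · rw [h] at a5; exact a5 (h1 x a2)
  have hΓM : Γ ⊆ pairs M := by
    intro g hg
    obtain ⟨e, he, rfl⟩ := Finset.mem_image.1 hg
    revert he
    induction e with
    | _ x y =>
      intro he
      obtain ⟨-, a2, a3, a4⟩ := hJm x y he
      rw [Sym2.map_mk, mk_mem_pairs]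
      exact ⟨h1 x a2, h1 y a3, a4⟩
  have hΓc := card_le_of_no_match hΓM (κ := κ) (by omega) (by
    intro N hN hNm hNc
    refine hno (containsForest_of_joined hM hMG h1 h2 h3 h4 (k := κ + 1) (by omega) hNm hNc ?_)
    intro g hg
    obtain ⟨e, he, rfl⟩ := Finset.mem_image.1 (hN hg)
    revert he
    induction e with
    | _ x y =>
      intro he
      obtain ⟨a1, a2, a3, a4⟩ := hJm x y he
      exact ⟨x, a2, y, a3, a1, by rw [Sym2.map_mk]⟩)
  -- Two disjoint matching edges are joined by at most four edges.
  have hJc : J.card ≤ 4 * Γ.card := by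
    refine Finset.card_le_mul_card_image J 4 ?_
    intro g hg
    induction g with
    | _ f f' =>
      have hff := mk_mem_pairs.1 (hΓM hg)
      have hsub : J.filter (Sym2.map F · = s(f, f')) ⊆
          (f.toFinset ×ˢ f'.toFinset).image fun x => s(x.1, x.2) := by
        intro e he
        obtain ⟨he, hef⟩ := Finset.mem_filter.1 he
        revert he hef
        induction e with
        | _ x y =>
          intro he hef
          rw [Sym2.map_mk, Sym2.eq_iff] at hef
          rw [Finset.mem_image]
          rcases hef with ⟨rfl, rfl⟩ | ⟨rfl, rfl⟩
          · exact ⟨(x, y), by simp [hF], rfl⟩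
          · exact ⟨(y, x), by simp [hF], Sym2.eq_swap⟩
      refine (Finset.card_le_card hsub).trans (Finset.card_image_le.trans ?_)
      rw [Finset.card_product, Sym2.card_toFinset_of_not_isDiag f (hM.nd f hff.1),
        Sym2.card_toFinset_of_not_isDiag f' (hM.nd f' hff.2.1)]
  have hGc : (G.filter (· ∈ pairs (cov M))).card ≤ M.card + J.card := by
    have : _ ≤ J.card + M.card := Finset.card_le_card_sdiff_add_card
    omega
  -- the neighbours of the uncovered vertices
  set S : V → Finset V := fun z => (nbr G z).filter fun x => μ x ∉ nbr G z with hS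
  set D : V → Finset V := fun z => (nbr G z).filter fun x => μ x ∈ nbr G z with hD
  have hcard : ∀ z, (nbr G z).card = (D z).card + (S z).card := fun z =>
    (Finset.card_filter_add_card_filter_not _).symm
  have hNc : ∀ z ∈ W \ cov M, nbr G z ⊆ cov M := fun z hz =>
    nbr_subset_cov hM hMG hnd hNB (hZM z hz)
  have hDsum : ∑ z ∈ W \ cov M, (D z).card ≤ 2 * M.card := by
    rw [← Finset.card_biUnion, ← hM.card_cov]
    · refine Finset.card_le_card (Finset.biUnion_subset.2 fun z hz => ?_)
      exact (Finset.filter_subset _ _).trans (hNc z hz)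
    · intro z hz z' hz' hne
      rw [Function.onFun, Finset.disjoint_left]
      intro x hx hx'
      obtain ⟨b1, b2⟩ := Finset.mem_filter.1 hx
      obtain ⟨b3, b4⟩ := Finset.mem_filter.1 hx'
      exact mate_notMem_nbr hM hMG hNB (hZM z hz) (hZM z' hz') hne (h1 x (hNc z hz b1)) b1 b4
  have hinj : ∀ z ∈ W \ cov M, Set.InjOn F (S z) := by
    intro z hz x hx y hy hxy
    obtain ⟨b1, b2⟩ := Finset.mem_filter.1 hx
    obtain ⟨b3, b4⟩ := Finset.mem_filter.1 hy
    rcases hFeq x (hNc z hz b1) y (hNc z hz b3) hxy with h | h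
    · exact h.symm
    · rw [h] at b3; exact absurd b3 b2
  have hSM : ∀ z ∈ W \ cov M, (S z).card ≤ M.card := by
    intro z hz
    rw [← Finset.card_image_of_injOn (hinj z hz)]
    refine Finset.card_le_card ?_
    intro f hf
    obtain ⟨x, hx, rfl⟩ := Finset.mem_image.1 hf
    exact h1 x (hNc z hz (Finset.mem_filter.1 hx).1)
  set B := (W \ cov M).filter fun z => 2 * (κ + 1) ≤ (S z).card with hB
  have hBc : B.card ≤ κ := by
    by_contra hlt
    push Not at hlt
    refine hno (containsForest_of_uncovered hM hMG h1 h2 h3 h4 (k := κ + 1) (by omega) (B := B)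
      (by omega) (fun z hz => hZM z (Finset.mem_filter.1 hz).1) ?_)
    intro z hz
    obtain ⟨hz1, hz2⟩ := Finset.mem_filter.1 hz
    refine hz2.trans ?_
    rw [← Finset.card_image_of_injOn (hinj z hz1)]
    refine Finset.card_le_card (Finset.image_subset_image ?_)
    intro x hx
    have hx' := (Finset.mem_filter.1 hx).1
    exact Finset.mem_filter.2 ⟨hx', hNc z hz1 hx'⟩
  have hSsum : ∑ z ∈ W \ cov M, (S z).card ≤
      (W \ cov M).card * (2 * κ + 1) + κ * (M.card - (2 * κ + 1)) := by
    -- All but at most κ of the sets `S z` have at most 2κ + 1 elements; the others have at most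
    -- |M|.
    have hle : ∀ z ∈ W \ cov M, (S z).card ≤
        (2 * κ + 1) + if 2 * (κ + 1) ≤ (S z).card then M.card - (2 * κ + 1) else 0 := by
      intro z hz
      have := hSM z hz
      split_ifs <;> omega
    refine (Finset.sum_le_sum hle).trans ?_
    rw [Finset.sum_add_distrib, Finset.sum_const, smul_eq_mul, ← Finset.sum_filter,
      Finset.sum_const, smul_eq_mul]
    exact Nat.add_le_add_left (Nat.mul_le_mul_right _ hBc) _
  have hsum : ∑ z ∈ W \ cov M, (nbr G z).card =
      ∑ z ∈ W \ cov M, (D z).card + ∑ z ∈ W \ cov M, (S z).card := by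
    rw [← Finset.sum_add_distrib]
    exact Finset.sum_congr rfl fun z _ => hcard z
  have hκr : κ * (M.card - (2 * κ + 1)) + κ * (2 * κ + 1) = κ * M.card := by
    rw [← Nat.mul_add, Nat.sub_add_cancel (by omega)]
  refine forest_arithmetic (r := M.card) (u := (W \ cov M).card) (γ := Γ.card)
    (d := ∑ z ∈ W \ cov M, (nbr G z).card) ht hn hr ?_ hg hΓc ?_ ?_
  · rw [← hM.card_cov, add_comm]; exact Finset.card_sdiff_add_card_eq_card hcW
  · omega
  · omega

end ForestCount

/-! ### From edge labelings to colorings of pairs. -/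

section Labelings

/-- A labeling of the edges of the complete graph as a function on all unordered pairs. -/
noncomputable def extend {V K : Type*} (c : TopEdgeLabeling V K) (e : Sym2 V) : Option K :=
  open Classical in if h : e ∈ (⊤ : SimpleGraph V).edgeSet then some (c ⟨e, h⟩) else none

theorem extend_coe {V K : Type*} (c : TopEdgeLabeling V K) (e : (⊤ : SimpleGraph V).edgeSet) :
    extend c e = some (c e) := by
  rw [extend, dif_pos e.2]

theorem le_card_colors_extend {n m : ℕ} {c : TopEdgeLabeling (Fin n) (Fin m)}
    (hc : Function.Surjective c) : m ≤ (colors (extend c) Finset.univ).card := by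
  have h : (Finset.univ : Finset (Fin m)).image some ⊆ colors (extend c) Finset.univ := by
    intro κ hκ
    obtain ⟨i, -, rfl⟩ := Finset.mem_image.1 hκ
    obtain ⟨e, rfl⟩ := hc i
    rw [← extend_coe]
    refine Finset.mem_image_of_mem _ ?_
    obtain ⟨e, he⟩ := e
    revert he
    induction e with
    | _ x y => intro he; simpa using he
  have := Finset.card_le_card h
  rwa [Finset.card_image_of_injective _ (Option.some_injective _), Finset.card_univ,
    Fintype.card_fin] at this

theorem hasRainbowCopy_of_containsForest {V K : Type*} [DecidableEq V]
    {c : TopEdgeLabeling V K} {G : Finset (Sym2 V)} (hi : Set.InjOn (extend c) G) {k t : ℕ}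
    (h : ContainsForest G k t) : HasRainbowCopy c (linearForest k t) := by
  obtain ⟨f, hf, hG⟩ := h
  let φ : linearForest k t →g (⊤ : SimpleGraph V) := ⟨f, fun h => hf.ne h.ne⟩
  have hmem : ∀ e : (linearForest k t).edgeSet, (φ.mapEdgeSet e : Sym2 V) ∈ G := by
    rintro ⟨e, he⟩
    revert he
    induction e with
    | _ x y => exact fun he => hG x y he
  refine ⟨φ.toCopy hf, fun e e' hee => ?_⟩
  refine Hom.mapEdgeSet.injective φ hf (Subtype.ext (hi (hmem e) (hmem e') ?_))
  rw [extend_coe, extend_coe]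
  exact congrArg some hee

/-- A coloring with many colors and a large rainbow matching contains a rainbow linear forest. -/
theorem hasRainbowCopy_of_hasRM {n m κ t : ℕ} {c : TopEdgeLabeling (Fin n) (Fin m)}
    (hc : Function.Surjective c) (ht : κ + 2 ≤ t) (hn : 8 * κ + 2 * t + 4 ≤ n)
    (hm : 2 * (2 * κ + t) * n + 4 ≤ 2 * m + (2 * κ + t) * (2 * κ + t + 1))
    (hRM : HasRM (extend c) Finset.univ (2 * (κ + 1) + t)) :
    HasRainbowCopy c (linearForest (κ + 1) t) := by
  obtain ⟨M, m1, m2, m3, m4⟩ := hRM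
  obtain ⟨G, hMG, hG⟩ := exists_isRep (extend c) Finset.univ m1 m3
  obtain ⟨M', n1, n2, n3⟩ := exists_max_match G
  have h1 := n3 M hMG m2
  have h2 := le_card_colors_extend hc
  rw [card_colors_eq hG] at h2
  refine hasRainbowCopy_of_containsForest hG.inj
    (containsForest_of_card hG.sub n2 n1 n3 ht ?_ (by omega) ?_)
  · rwa [Finset.card_univ, Fintype.card_fin]
  · rw [Finset.card_univ, Fintype.card_fin]; omega

theorem isMatch_image {ι V : Type*} [Fintype ι] [DecidableEq V] {lo hi : ι → V}
    (h1 : Function.Injective lo) (h2 : Function.Injective hi) (h3 : ∀ i j, lo i ≠ hi j) :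
    IsMatch (Finset.univ.image fun i => s(lo i, hi i)) ∧
      (Finset.univ.image fun i => s(lo i, hi i)).card = Fintype.card ι := by
  refine ⟨⟨?_, ?_⟩, Finset.card_image_of_injective _ ?_⟩
  · intro e he
    obtain ⟨i, -, rfl⟩ := Finset.mem_image.1 he
    simpa using h3 i i
  · intro e he f hf x hx hx'
    obtain ⟨i, -, rfl⟩ := Finset.mem_image.1 he
    obtain ⟨j, -, rfl⟩ := Finset.mem_image.1 hf
    rw [Sym2.mem_iff] at hx hx'
    rcases hx with rfl | rfl <;> rcases hx' with h | h
    · rw [h1 h]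
    · exact absurd h (h3 _ _)
    · exact absurd h.symm (h3 _ _)
    · rw [h2 h]
  · intro i j hij
    rcases Sym2.eq_iff.1 hij with ⟨h, -⟩ | ⟨h, -⟩
    · exact h1 h
    · exact absurd h (h3 _ _)

/-- A rainbow copy of `k P₄ ∪ t P₂` contains a rainbow matching with `2k + t` edges. -/
theorem hasRM_of_hasRainbowCopy {n k t : ℕ} {K : Type*} {c : TopEdgeLabeling (Fin n) K}
    (h : HasRainbowCopy c (linearForest k t)) {K' : Type*} (c' : Sym2 (Fin n) → K')
    (hc : ∀ e f : (⊤ : SimpleGraph (Fin n)).edgeSet, c' e = c' f → c e = c f) :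
    HasRM c' Finset.univ (2 * k + t) := by
  obtain ⟨f, hf⟩ := h
  have hfi : Function.Injective f.toHom := f.injective'
  -- The matching consists of the edges 01 and 23 of every P₄ and of all edges P₂.
  let lo : (Fin k × Fin 2) ⊕ Fin t → (Fin k × Fin 4) ⊕ (Fin t × Fin 2) :=
    Sum.map (fun x => (x.1, ![0, 2] x.2)) (fun j => (j, 0))
  let hi : (Fin k × Fin 2) ⊕ Fin t → (Fin k × Fin 4) ⊕ (Fin t × Fin 2) :=
    Sum.map (fun x => (x.1, ![1, 3] x.2)) (fun j => (j, 1))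
  have h1 : Function.Injective lo := by
    refine Sum.map_injective.2 ⟨?_, fun i j h => (Prod.mk.inj h).1⟩
    rintro ⟨i, a⟩ ⟨j, b⟩ h
    obtain ⟨rfl, h⟩ := Prod.mk.inj h
    revert h
    fin_cases a <;> fin_cases b <;> simp
  have h2 : Function.Injective hi := by
    refine Sum.map_injective.2 ⟨?_, fun i j h => (Prod.mk.inj h).1⟩
    rintro ⟨i, a⟩ ⟨j, b⟩ h
    obtain ⟨rfl, h⟩ := Prod.mk.inj h
    revert h
    fin_cases a <;> fin_cases b <;> simp
  have h3 : ∀ i j, lo i ≠ hi j := by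
    rintro (⟨i, a⟩ | i) (⟨j, b⟩ | j) h
    · have h := (Prod.mk.inj (Sum.inl.inj h)).2
      revert h
      fin_cases a <;> fin_cases b <;> simp
    · simp [lo, hi] at h
    · simp [lo, hi] at h
    · simp [lo, hi] at h
  have hadj : ∀ i, (linearForest k t).Adj (lo i) (hi i) := by
    rintro (⟨i, a⟩ | i)
    · have : (pathGraph 4).Adj (![0, 2] a) (![1, 3] a) := by
        rw [pathGraph_adj]; fin_cases a <;> simp
      exact ⟨rfl, this⟩
    · have : (pathGraph 2).Adj 0 1 := by rw [pathGraph_adj]; simp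
      exact ⟨rfl, this⟩
  obtain ⟨hm, hcard⟩ := isMatch_image (hfi.comp h1) (hfi.comp h2) fun i j h => h3 i j (hfi h)
  refine ⟨_, ?_, hm, ?_, hcard.trans (by simp; ring)⟩
  · intro e he
    have hd := hm.nd e he
    revert hd
    induction e with
    | _ x y => simp
  · intro e he e' he' hee
    obtain ⟨i, -, rfl⟩ := Finset.mem_image.1 (Finset.mem_coe.1 he)
    obtain ⟨j, -, rfl⟩ := Finset.mem_image.1 (Finset.mem_coe.1 he')
    have := hc (f.toHom.mapEdgeSet ⟨s(lo i, hi i), hadj i⟩)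
      (f.toHom.mapEdgeSet ⟨s(lo j, hi j), hadj j⟩) hee
    have := congrArg (fun e : (linearForest k t).edgeSet => Sym2.map f.toHom e) (hf this)
    exact this

theorem card_colors_le_antiRamsey {n k t : ℕ} {K : Type*} [DecidableEq K]
    {c : Sym2 (Fin n) → K} (h : ¬ HasRM c Finset.univ (2 * k + t)) :
    (colors c Finset.univ).card ≤ antiRamsey n (linearForest k t) := by
  refine le_csSup (bddAbove_rainbowFreeColorCounts _ _) ?_
  let E : colors c Finset.univ ≃ Fin (colors c Finset.univ).card :=
    (colors c Finset.univ).equivFin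
  have hmem : ∀ e : (⊤ : SimpleGraph (Fin n)).edgeSet, c e ∈ colors c Finset.univ := by
    rintro ⟨e, he⟩
    refine Finset.mem_image_of_mem _ ?_
    revert he
    induction e with
    | _ x y => intro he; simpa using he
  refine ⟨fun e => E ⟨c e, hmem e⟩, ?_, fun hcopy => h (hasRM_of_hasRainbowCopy hcopy c ?_)⟩
  · intro i
    obtain ⟨e, he, hce⟩ := Finset.mem_image.1 (E.symm i).2
    have he' : e ∈ (⊤ : SimpleGraph (Fin n)).edgeSet := by
      revert he
      induction e with
      | _ x y => simp
    refine ⟨⟨e, he'⟩, ?_⟩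
    simp only [hce, Subtype.coe_eta, Equiv.apply_symm_apply]
  · intro e f hef
    simp only [hef]

end Labelings

/-! ### Extremal colorings. -/

section LowerBounds

variable {n : ℕ}

/-- All edges in `Γ` get their own color, and all other edges get one common color. -/
theorem card_add_one_le_antiRamsey {Γ : Finset (Sym2 (Fin n))} (hΓ : Γ ⊂ pairs Finset.univ)
    {k t : ℕ} (h : ∀ M ⊆ Γ, IsMatch M → M.card + 1 < 2 * k + t) :
    Γ.card + 1 ≤ antiRamsey n (linearForest k t) := by
  set c : Sym2 (Fin n) → Option (Sym2 (Fin n)) := fun e => if e ∈ Γ then some e else none with hc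
  refine le_trans ?_ (card_colors_le_antiRamsey (c := c) ?_)
  · obtain ⟨f, hf, hfΓ⟩ := Finset.exists_of_ssubset hΓ
    have hsub : insert none (Γ.image some) ⊆ colors c Finset.univ := by
      refine Finset.insert_subset (Finset.mem_image.2 ⟨f, hf, by simp [hc, hfΓ]⟩) ?_
      intro κ hκ
      obtain ⟨e, he, rfl⟩ := Finset.mem_image.1 hκ
      exact Finset.mem_image.2 ⟨e, hΓ.1 he, by simp [hc, he]⟩
    have := Finset.card_le_card hsub
    rwa [Finset.card_insert_of_notMem (by simp),
      Finset.card_image_of_injective _ (Option.some_injective _)] at this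
  · rintro ⟨M, m1, m2, m3, m4⟩
    have h1 : (M.filter (· ∉ Γ)).card ≤ 1 := by
      rw [Finset.card_le_one]
      intro e he f hf
      rw [Finset.mem_filter] at he hf
      exact m3 he.1 hf.1 (by simp [hc, he.2, hf.2])
    have h2 := Finset.card_filter_add_card_filter_not (s := M) (· ∈ Γ)
    have h3 := h (M.filter (· ∈ Γ)) (fun e he => (Finset.mem_filter.1 he).2)
      (m2.mono (Finset.filter_subset _ _))
    omega

theorem exists_card_eq (n : ℕ) {a : ℕ} (h : a ≤ n) : ∃ A : Finset (Fin n), A.card = a := by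
  obtain ⟨A, -, hA⟩ := Finset.exists_subset_card_eq
    (show a ≤ (Finset.univ : Finset (Fin n)).card by simpa using h)
  exact ⟨A, hA⟩

theorem pairs_ssubset_univ {A : Finset (Fin n)} {x : Fin n} (hx : x ∉ A) (hn : 2 ≤ n) :
    pairs A ⊂ pairs Finset.univ := by
  refine Finset.ssubset_iff_subset_ne.2 ⟨pairs_mono (Finset.subset_univ _), fun h => ?_⟩
  have : Nontrivial (Fin n) := Fin.nontrivial_iff_two_le.2 hn
  obtain ⟨y, hy⟩ := exists_ne x
  have hxy : s(x, y) ∈ pairs A := by rw [h]; simp [hy.symm]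
  exact hx (mk_mem_pairs.1 hxy).1

/-- A clique on 2σ + 1 vertices has no σ + 1 disjoint edges. -/
theorem le_antiRamsey_of_clique {k t σ : ℕ} (hσ : σ + 2 = 2 * k + t) (hn : 2 * σ + 4 ≤ n) :
    σ * (2 * σ + 1) + 1 ≤ antiRamsey n (linearForest k t) := by
  obtain ⟨A, hA⟩ := exists_card_eq n (show 2 * σ + 1 ≤ n by omega)
  obtain ⟨x, hx⟩ : ∃ x, x ∉ A := by
    by_contra hcon
    push Not at hcon
    rw [Finset.eq_univ_of_forall hcon, Finset.card_univ, Fintype.card_fin] at hA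
    omega
  have h := card_add_one_le_antiRamsey (k := k) (t := t) (pairs_ssubset_univ hx (by omega)) (by
    intro M hM hm
    have := Finset.card_le_card (cov_subset hM)
    rw [hm.card_cov, hA] at this
    omega)
  rw [card_pairs, hA] at h
  have := two_mul_choose_two (2 * σ + 1)
  nlinarith

/-- At most σ disjoint edges can meet a set of σ vertices. -/
theorem le_antiRamsey_of_star {k t σ : ℕ} (hσ : σ + 2 = 2 * k + t) (hn : 2 * σ + 4 ≤ n) :
    2 * σ * n + 2 ≤ 2 * antiRamsey n (linearForest k t) + σ * (σ + 1) := by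
  obtain ⟨S, hS⟩ := exists_card_eq n (show σ ≤ n by omega)
  set Γ := pairs (Finset.univ : Finset (Fin n)) \ pairs Sᶜ with hΓ
  have hSc : Sᶜ.card = n - σ := by rw [Finset.card_compl, Fintype.card_fin, hS]
  have hΓc : Γ.card + (n - σ).choose 2 = n.choose 2 := by
    have := Finset.card_sdiff_add_card_eq_card
      (pairs_mono (Finset.subset_univ Sᶜ))
    rwa [card_pairs, card_pairs, hSc, Finset.card_univ, Fintype.card_fin] at this
  have h := card_add_one_le_antiRamsey (Γ := Γ) (k := k) (t := t) (by
    refine Finset.ssubset_iff_subset_ne.2 ⟨Finset.sdiff_subset, fun h => ?_⟩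
    have h1 : 0 < (n - σ).choose 2 := Nat.choose_pos (by omega)
    have h2 := card_pairs (Finset.univ : Finset (Fin n))
    rw [Finset.card_univ, Fintype.card_fin, ← h] at h2
    omega) (by
    intro M hM hm
    have hx : ∀ e ∈ M, ∃ x ∈ S, x ∈ e := by
      intro e he
      have h1 := hM he
      by_contra hcon
      push Not at hcon
      rw [hΓ, Finset.mem_sdiff] at h1
      refine h1.2 ?_
      have hd := not_isDiag_of_mem_pairs h1.1
      revert hcon hd
      induction e with
      | _ x y =>
        intro hcon hd
        rw [mk_mem_pairs, Finset.mem_compl, Finset.mem_compl]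
        exact ⟨fun h => hcon x h (by simp), fun h => hcon y h (by simp), by simpa using hd⟩
    have : Nonempty (Fin n) := ⟨⟨0, by omega⟩⟩
    choose! g hg hge using hx
    have := Finset.card_le_card_of_injOn g hg (fun e he f hf hef =>
      hm.disj e he f hf (g e) (hge e he) (by rw [hef]; exact hge f hf))
    omega)
  obtain ⟨w, rfl⟩ : ∃ w, n = σ + w := ⟨n - σ, by omega⟩
  rw [Nat.add_sub_cancel_left] at hΓc
  have e1 := two_mul_choose_two w
  have e2 := two_mul_choose_two (σ + w)
  nlinarith

/-- Outside a rainbow clique on 2σ + 1 vertices, one extra color is given to x₂x₃ and the edges from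
x₁ to the clique, the other to the remaining edges. A matching with σ + 2 edges is perfect, so it
covers all three xᵢ, and this repeats an extra color. -/
theorem le_antiRamsey_of_even {k t σ : ℕ} (hσ : σ + 2 = 2 * k + t) (hn : n = 2 * σ + 4) :
    σ * (2 * σ + 1) + 2 ≤ antiRamsey n (linearForest k t) := by
  obtain ⟨A, hA⟩ := exists_card_eq n (show 2 * σ + 1 ≤ n by omega)
  have hAc : Aᶜ.card = 3 := by rw [Finset.card_compl, Fintype.card_fin, hA]; omega
  obtain ⟨x₁, x₂, x₃, h12, h13, h23, hX⟩ := Finset.card_eq_three.1 hAc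
  have hmem : ∀ x, x ∉ A ↔ x = x₁ ∨ x = x₂ ∨ x = x₃ := by
    intro x; rw [← Finset.mem_compl, hX]; simp
  have n1 : x₁ ∉ A := (hmem _).2 (by simp)
  have n2 : x₂ ∉ A := (hmem _).2 (by simp)
  have n3 : x₃ ∉ A := (hmem _).2 (by simp)
  set P : Sym2 (Fin n) → Prop := fun e => e = s(x₂, x₃) ∨ (x₁ ∈ e ∧ x₂ ∉ e ∧ x₃ ∉ e) with hP
  set c : Sym2 (Fin n) → Sym2 (Fin n) ⊕ Bool := fun e =>
    if e ∈ pairs A then Sum.inl e else Sum.inr (decide (P e)) with hc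
  have hout : ∀ e x, x ∉ A → x ∈ e → c e = Sum.inr (decide (P e)) := by
    intro e x hx hxe
    refine if_neg fun he => hx ?_
    exact Finset.mem_sym2_iff.1 (Finset.mem_filter.1 he).1 x hxe
  refine le_trans ?_ (card_colors_le_antiRamsey (c := c) ?_)
  · have hsub : (pairs A).disjSum Finset.univ ⊆ colors c Finset.univ := by
      intro κ hκ
      rcases Finset.mem_disjSum.1 hκ with ⟨e, he, rfl⟩ | ⟨b, -, rfl⟩
      · exact Finset.mem_image.2 ⟨e, pairs_mono (Finset.subset_univ _) he, by simp [hc, he]⟩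
      · cases b
        · refine Finset.mem_image.2 ⟨s(x₁, x₂), by simp [h12], ?_⟩
          rw [hout _ x₁ n1 (by simp)]
          simp [hP, h12, h13]
        · refine Finset.mem_image.2 ⟨s(x₂, x₃), by simp [h23], ?_⟩
          rw [hout _ x₂ n2 (by simp)]
          simp [hP]
    have h := Finset.card_le_card hsub
    rw [Finset.card_disjSum, card_pairs, hA, Finset.card_univ, Fintype.card_bool] at h
    have := two_mul_choose_two (2 * σ + 1)
    nlinarith
  · rintro ⟨M, m1, m2, m3, m4⟩
    have hcov : cov M = Finset.univ := by
      refine Finset.eq_univ_of_card _ ?_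
      rw [m2.card_cov, m4, Fintype.card_fin]; omega
    have hex : ∀ x, ∃ e ∈ M, x ∈ e := fun x => mem_cov.1 (by rw [hcov]; simp)
    obtain ⟨e₁, a1, b1⟩ := hex x₁
    obtain ⟨e₂, a2, b2⟩ := hex x₂
    obtain ⟨e₃, a3, b3⟩ := hex x₃
    have hEq : ∀ e ∈ M, ∀ f ∈ M, ∀ x ∈ e, ∀ y ∈ f, x ∉ A → y ∉ A → (P e ↔ P f) → e = f := by
      intro e he f hf x hx y hy hxA hyA h
      refine m3 he hf ?_
      rw [hout e x hxA hx, hout f y hyA hy]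
      simp [h]
    have q12 := hEq _ a1 _ a2 _ b1 _ b2 n1 n2
    have q13 := hEq _ a1 _ a3 _ b1 _ b3 n1 n3
    have q23 := hEq _ a2 _ a3 _ b2 _ b3 n2 n3
    have d12 := m2.disj e₁ a1 e₂ a2
    have d13 := m2.disj e₁ a1 e₃ a3
    have d23 := m2.disj e₂ a2 e₃ a3
    have key : ∀ e : Sym2 (Fin n), ∀ x y, x ≠ y → x ∈ e → y ∈ e → e = s(x, y) :=
      fun e x y hxy hx hy => (Sym2.mem_and_mem_iff hxy).1 ⟨hx, hy⟩
    -- If two of the xᵢ are matched to each other, the edge at the third has the same color;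
    -- otherwise three edges share two colors.
    by_cases E12 : e₁ = e₂
    · subst E12
      obtain rfl := key e₁ x₁ x₂ h12 b1 b2
      have p1 : ¬ P s(x₁, x₂) := by simp [hP, h12, h13]
      have p3 : ¬ P e₃ := by
        rintro (rfl | ⟨h, -⟩)
        · exact absurd (d23 x₂ b2 (by simp)) (by simp [h12, h13])
        · have h3 := d13 x₁ (by simp) h
          rw [← h3] at b3
          simp [h13.symm, h23.symm] at b3
      have h3 := q13 (iff_of_false p1 p3)
      rw [← h3] at b3
      simp [h13.symm, h23.symm] at b3
    by_cases E13 : e₁ = e₃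
    · subst E13
      obtain rfl := key e₁ x₁ x₃ h13 b1 b3
      have p1 : ¬ P s(x₁, x₃) := by simp [hP, h12, h13]
      have p3 : ¬ P e₂ := by
        rintro (rfl | ⟨h, -⟩)
        · exact E12 (d12 x₃ (by simp) (by simp))
        · exact E12 (d12 x₁ (by simp) h)
      exact E12 (q12 (iff_of_false p1 p3))
    by_cases E23 : e₂ = e₃
    · subst E23
      obtain rfl := key e₂ x₂ x₃ h23 b2 b3
      have p2 : P s(x₂, x₃) := Or.inl rfl
      have p1 : P e₁ := Or.inr ⟨b1, fun h => E12 (d12 x₂ h b2), fun h => E12 (d12 x₃ h b3)⟩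
      exact E12 (q12 (iff_of_true p1 p2))
    have pigeon : ∀ a b d : Prop, ¬ (a ↔ b) → ¬ (a ↔ d) → (b ↔ d) := by tauto
    exact E23 (q23 (pigeon _ _ _ (fun h => E12 (q12 h)) (fun h => E13 (q13 h))))

end LowerBounds

/-! ### The upper bound and the final formulas. -/

/-- The extra condition `hex` excludes the extremal colorings of order 2σ + 4, where σ = 2κ + t. -/
theorem hasRainbowCopy_of_big {n m κ t : ℕ} {c : TopEdgeLabeling (Fin n) (Fin m)}
    (hc : Function.Surjective c) (ht : κ + 2 ≤ t) (hn : 8 * κ + 2 * t + 4 ≤ n)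
    (hm : Big (2 * κ + t) n m)
    (hex : n = 2 * (2 * κ + t) + 4 → 5 ≤ 2 * κ + t →
      (2 * κ + t) * (2 * (2 * κ + t) + 1) + 2 < m) :
    HasRainbowCopy c (linearForest (κ + 1) t) := by
  refine hasRainbowCopy_of_hasRM hc ht hn hm.2 ?_
  have hle := le_card_colors_extend hc
  have hu : (Finset.univ : Finset (Fin n)).card = n := by simp
  have hb : Big (2 * κ + t) (Finset.univ : Finset (Fin n)).card
      (colors (extend c) Finset.univ).card := by
    obtain ⟨h1, h2⟩ := hm
    rw [hu]
    exact ⟨by omega, by omega⟩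
  obtain ⟨hT, hE⟩ := bounds (extend c) (2 * κ + t)
  rw [show 2 * (κ + 1) + t = 2 * κ + t + 2 by ring]
  by_cases hn' : 2 * (2 * κ + t) + 5 ≤ n
  · exact hT _ (by omega) hb
  · by_contra hno
    obtain ⟨h5, -, h3⟩ := hE (by omega) _ (by omega) hb hno
    have := hex (by omega) h5
    omega

theorem not_big_antiRamsey {n κ t : ℕ} (ht : κ + 2 ≤ t) (hn : 8 * κ + 2 * t + 4 ≤ n)
    (hne : ¬ (κ = 0 ∧ 5 ≤ t ∧ n = 2 * t + 4)) :
    ¬ Big (2 * κ + t) n (antiRamsey n (linearForest (κ + 1) t)) := by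
  intro hb
  have hne' : (rainbowFreeColorCounts n (linearForest (κ + 1) t)).Nonempty := by
    by_contra hemp
    rw [Set.not_nonempty_iff_eq_empty] at hemp
    -- The supremum of the empty set is 0, which `Big` does not allow.
    have := hb.1
    rw [antiRamsey, hemp] at this
    simp at this
  obtain ⟨c, hc, hno⟩ := (isGreatest_antiRamsey hne').1
  exact hno (hasRainbowCopy_of_big hc ht hn hb fun h5 h6 => absurd ⟨by omega, by omega, by omega⟩ hne)

theorem antiRamsey_le_of_even {t : ℕ} (ht : 5 ≤ t) :
    antiRamsey (2 * t + 4) (linearForest 1 t) ≤ t * (2 * t + 1) + 2 := by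
  refine csSup_le' ?_
  rintro m ⟨c, hc, hno⟩
  by_contra hlt
  push Not at hlt
  refine hno (hasRainbowCopy_of_big (κ := 0) hc (by omega) (by omega) ?_ ?_)
  · simp only [mul_zero, zero_add]
    constructor <;> nlinarith
  · intro _ _
    simpa using hlt

theorem antiRamsey_bounds {n κ t : ℕ} (ht : κ + 2 ≤ t) (hn : 8 * κ + 2 * t + 4 ≤ n)
    (hne : ¬ (κ = 0 ∧ 5 ≤ t ∧ n = 2 * t + 4)) {σ : ℕ} (hσ : σ = 2 * κ + t) :
    σ * (2 * σ + 1) + 1 ≤ antiRamsey n (linearForest (κ + 1) t) ∧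
    2 * σ * n + 2 ≤ 2 * antiRamsey n (linearForest (κ + 1) t) + σ * (σ + 1) ∧
    (antiRamsey n (linearForest (κ + 1) t) ≤ σ * (2 * σ + 1) + 1 ∨
      2 * antiRamsey n (linearForest (κ + 1) t) + σ * (σ + 1) ≤ 2 * σ * n + 2) := by
  refine ⟨le_antiRamsey_of_clique (by omega) (by omega),
    le_antiRamsey_of_star (by omega) (by omega), ?_⟩
  have h := not_big_antiRamsey ht hn hne
  rw [← hσ, Big, not_and_or] at h
  -- The failure of `Big` leaves 2σn + 3 on the right; parity lowers it to 2σn + 2.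
  obtain ⟨j, hj⟩ := Nat.even_mul_succ_self σ
  rw [Nat.mul_assoc] at h ⊢
  omega

end RainbowForest

theorem corollary1 (k t n : ℕ) (hk : 2 ≤ k + 1) (ht : k + 1 ≤ t) (hn : 8 * k + 2 * t - 4 ≤ n) :
    (k = 1 → t = 2 → n = 8 → antiRamsey n (linearForest k t) = 14) ∧
    (k = 1 → 5 ≤ t → n = 2 * t + 4 →
      antiRamsey n (linearForest k t) = t * (2 * t + 1) + 2) ∧
    (¬ (k = 1 ∧ 5 ≤ t ∧ n = 2 * t + 4) →
      ((n : ℝ) ≤ (5 * (2 * k + t) - 7) / 2 →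
        (antiRamsey n (linearForest k t) : ℝ) =
          (2 * k + t - 2) * (4 * k + 2 * t - 3) + 1) ∧
      ((5 * (2 * k + t) - 7) / 2 ≤ (n : ℝ) →
        (antiRamsey n (linearForest k t) : ℝ) =
          (2 * k + t - 2) * (n - (2 * k + t - 1) / 2) + 1)) := by
  obtain ⟨κ, rfl⟩ : ∃ κ, k = κ + 1 := ⟨k - 1, by omega⟩
  refine ⟨?_, ?_, ?_⟩
  · intro hk1 ht2 hn8
    obtain rfl : κ = 0 := by omega
    subst ht2 hn8
    obtain ⟨-, h1, h2⟩ := RainbowForest.antiRamsey_bounds (κ := 0) (t := 2) (n := 8) (σ := 2)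
      le_rfl (by omega) (by omega) rfl
    omega
  · intro hk1 ht5 hn'
    obtain rfl : κ = 0 := by omega
    subst hn'
    exact le_antisymm (RainbowForest.antiRamsey_le_of_even ht5)
      (RainbowForest.le_antiRamsey_of_even (by omega) rfl)
  · intro hne
    obtain ⟨h1, h2, h3⟩ := RainbowForest.antiRamsey_bounds (κ := κ) (t := t) (n := n)
      (σ := 2 * κ + t) (by omega) (by omega) (by omega) rfl
    generalize antiRamsey n (linearForest (κ + 1) t) = R at h1 h2 h3 ⊢
    obtain ⟨σ, hσ⟩ : ∃ σ, σ = 2 * κ + t := ⟨_, rfl⟩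
    rw [← hσ] at h1 h2 h3
    have hσ' : (2 * κ + t : ℝ) = σ := by rw [hσ]; push_cast; ring
    have hs : (2 * ((κ + 1 : ℕ) : ℝ) + t) = σ + 2 := by rw [← hσ']; push_cast; ring
    have hs' : (4 * ((κ + 1 : ℕ) : ℝ) + 2 * t - 3) = 2 * σ + 1 := by
      rw [← hσ']; push_cast; ring
    rw [hs, hs']
    constructor
    · intro hle
      -- On this side of the threshold the clique value is at least the star value, so either
      -- alternative in `h3` gives the clique value.
      have hle' : 2 * n ≤ 5 * σ + 3 := by
        have : (2 * n : ℝ) ≤ 5 * σ + 3 := by linarith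
        exact_mod_cast this
      have hR : R = σ * (2 * σ + 1) + 1 := by
        refine le_antisymm ?_ h1
        rcases h3 with h3 | h3
        · exact h3
        · nlinarith
      rw [hR]; push_cast; ring
    · intro hle
      have hle' : 5 * σ + 3 ≤ 2 * n := by
        have : (5 * σ + 3 : ℝ) ≤ 2 * n := by linarith
        exact_mod_cast this
      have hR : 2 * R + σ * (σ + 1) = 2 * σ * n + 2 := by
        refine le_antisymm ?_ h2
        rcases h3 with h3 | h3
        · nlinarith
        · exact h3
      have hR' : (2 * R + σ * (σ + 1) : ℝ) = 2 * σ * n + 2 := by exact_mod_cast hR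
      linarith
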